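/- Let $1<p<\infty$, $d\ge 0$ an integer, $T\in[0,\infty)$, and let $(\Omega,\mathcal F,(\mathcal F_t)_{t\in[0,T]},P)$ be a filtered probability space satisfying the usual conditions (the filtration is right-continuous and $\mathcal F_0$ contains every subset of every $P$-null set). Write $E_t(\cdot)=E[\,\cdot\mid\mathcal F_t]$, and let $L^p(\mathcal F_t)^d$ be the Banach space of classes of $\mathcal F_t$-measurable $\mathbb R^d$-valued random vectors $X$ with $\|X\|_p=(E|X|^p)^{1/p}<\infty$, $|\cdot|$ being the Euclidean norm. Let $S^p$ be the space of $\mathbb R^d$-valued adapted processes $Y=(Y_t)_{t\in[0,T]}$, right-continuous with left limits, with $\bigl\|\sup_{0\le t\le T}|Y_t|\bigr\|_p<\infty$, where two processes $X,Y$ are identified if $X_t=Y_t$ a.s. for every $t\in[0,T]$. Put $S^p_0=\{Y\in S^p: Y_0=0\}$ and $M^p_0=\{M\in S^p_0: M\text{ is a martingale}\}$. Let $F:S^p\times M^p_0\to S^p_0$ and $\xi\in L^p(\mathcal F_T)^d$, and consider the backward stochastic equation $$Y_t+F_t(Y,M)+M_t=\xi+F_T(Y,M)+M_T\qquad\text{for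 all }t\in[0,T].\tag{BSE}$$ Assume that $F$ satisfies condition (S): for all $y\in L^p(\mathcal F_0)^d$ and $M\in M^p_0$ there is exactly one $Y\in S^p$ with $Y_t=y-F_t(Y,M)-M_t$ for all $t\in[0,T]$. For $V\in L^p(\mathcal F_T)^d$ let $M^V\in M^p_0$ be the martingale $M^V_t=E_0(V)-E_t(V)$, let $Y^V\in S^p$ be the unique solution of $Y_t=E_0(V)-F_t(Y,M^V)-M^V_t$, $t\in[0,T]$, and set $$G(V)=\xi+F_T(Y^V,M^V)\in L^p(\mathcal F_T)^d .$$ Assume that $G$ is nonexpansive, that is, $\|G(V)-G(V')\|_p\le\|V-V'\|_p$ for all $V,V'\in L^p(\mathcal F_T)^d$, and that there is a nonempty bounded closed convex set $H\subset L^p(\mathcal F_T)^d$ with $G(H)\subset H$. Then (BSE) has a solution $(Y,M)\in S^p\times M^p_0$. -/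

import Mathlib

open MeasureTheory Filter Topology
open scoped ENNReal NNReal

namespace ClassicalBSE

/-- The time interval `[0, T]`. -/
abbrev TimeSet (T : ℝ≥0) : Type := Set.Icc (0 : ℝ≥0) T

/-- The initial time `0` of `[0, T]`. -/
def initialTime (T : ℝ≥0) : TimeSet T := ⟨0, le_rfl, zero_le⟩

/-- The terminal time `T` of `[0, T]`. -/
def terminalTime (T : ℝ≥0) : TimeSet T := ⟨T, zero_le, le_rfl⟩

section Spaces

variable {Ω : Type*} {mΩ : MeasurableSpace Ω} {T : ℝ≥0}

/-- The usual conditions: the filtration is right-continuous, and `𝓕 0` contains every subset of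
`Ω` of outer measure zero (in particular the probability space is complete). -/
structure UsualConditions (𝓕 : Filtration (TimeSet T) mΩ) (P : Measure Ω) : Prop where
  rightContinuous : 𝓕.IsRightContinuous
  null_measurable : ∀ s : Set Ω, P s = 0 → MeasurableSet[𝓕 (initialTime T)] s

/-- The Banach space `L^p(𝓕_t)^d` of classes of `𝓕_t`-measurable `p`-integrable
`ℝ^d`-valued random vectors. -/
noncomputable abbrev LpAt (𝓕 : Filtration (TimeSet T) mΩ) (P : Measure Ω) (p : ℝ≥0∞) (d : ℕ) (t : TimeSet T) :
    Submodule ℝ (Lp (EuclideanSpace ℝ (Fin d)) p P) :=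
  lpMeas (EuclideanSpace ℝ (Fin d)) ℝ (𝓕 t) p P

/-- An `ℝ^d`-valued RCLL adapted process `Y` on `[0, T]` with `‖sup_t |Y_t|‖_p < ∞`. -/
structure SpProcess (𝓕 : Filtration (TimeSet T) mΩ) (P : Measure Ω) (p : ℝ≥0∞) (d : ℕ) where
  path : TimeSet T → Ω → EuclideanSpace ℝ (Fin d)
  adapted : StronglyAdapted 𝓕 path
  rightContinuous : ∀ ω t, Tendsto (fun s => path s ω) (𝓝[>] t) (𝓝 (path t ω))
  leftLimit : ∀ ω t, ∃ l, Tendsto (fun s => path s ω) (𝓝[<] t) (𝓝 l)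
  sup_finite : eLpNorm (fun ω => ⨆ t, ‖path t ω‖ₑ) p P < ∞

/-- Stochastic equivalence of processes: `X_t = Y_t` almost surely, for every `t`. -/
instance SpProcess.setoid (𝓕 : Filtration (TimeSet T) mΩ) (P : Measure Ω) (p : ℝ≥0∞) (d : ℕ) :
    Setoid (SpProcess 𝓕 P p d) where
  r X Y := ∀ t, X.path t =ᵐ[P] Y.path t
  iseqv := ⟨fun _ _ => EventuallyEq.rfl, fun h t => (h t).symm, fun h h' t => (h t).trans (h' t)⟩

/-- The space `S^p`: RCLL adapted processes with `‖sup_t |Y_t|‖_p < ∞`, up to stochastic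
equivalence. -/
def Sp (𝓕 : Filtration (TimeSet T) mΩ) (P : Measure Ω) (p : ℝ≥0∞) (d : ℕ) : Type _ :=
  Quotient (SpProcess.setoid 𝓕 P p d)

variable {𝓕 : Filtration (TimeSet T) mΩ} {P : Measure Ω} {p : ℝ≥0∞} {d : ℕ}

theorem SpProcess.memLp (X : SpProcess 𝓕 P p d) (t : TimeSet T) : MemLp (X.path t) p P := by
  refine ⟨((X.adapted t).mono (𝓕.le t)).aestronglyMeasurable, lt_of_le_of_lt ?_ X.sup_finite⟩
  exact eLpNorm_mono_enorm fun ω => by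
    simpa using le_iSup (fun s => ‖X.path s ω‖ₑ) t

/-- The value `X_t` of a process, as a class in `L^p(𝓕_t)^d`. -/
noncomputable def SpProcess.value (X : SpProcess 𝓕 P p d) (t : TimeSet T) : LpAt 𝓕 P p d t :=
  ⟨(X.memLp t).toLp (X.path t),
    mem_lpMeas_iff_aestronglyMeasurable.mpr
      ((X.adapted t).aestronglyMeasurable.congr (X.memLp t).coeFn_toLp.symm)⟩

/-- The value `Y_t` of an element of `S^p`, as a class in `L^p(𝓕_t)^d`. -/
noncomputable def Sp.value (Y : Sp 𝓕 P p d) (t : TimeSet T) : LpAt 𝓕 P p d t :=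
  Quotient.lift (fun X : SpProcess 𝓕 P p d => X.value t)
    (fun X X' (h : ∀ s, X.path s =ᵐ[P] X'.path s) =>
      Subtype.ext ((MemLp.toLp_eq_toLp_iff (X.memLp t) (X'.memLp t)).mpr (h t))) Y

/-- The class of a process in `S^p`. -/
def SpProcess.toSp (X : SpProcess 𝓕 P p d) : Sp 𝓕 P p d :=
  Quotient.mk _ X

/-- An element of `S^p` is a martingale if it is the class of a martingale. -/
def Sp.IsMartingale (Y : Sp 𝓕 P p d) : Prop :=
  ∃ X : SpProcess 𝓕 P p d, X.toSp = Y ∧ Martingale X.path 𝓕 P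

variable (𝓕 P p d)

/-- The space `S^p_0` of elements of `S^p` with `Y_0 = 0`. -/
def Sp0 : Type _ := {Y : Sp 𝓕 P p d // Y.value (initialTime T) = 0}

/-- The space `M^p_0` of martingales in `S^p` with `M_0 = 0`. -/
def Mp0 : Type _ := {M : Sp 𝓕 P p d // M.IsMartingale ∧ M.value (initialTime T) = 0}

variable {𝓕 P p d}

/-- The value `Y_t` of an element of `S^p_0`. -/
noncomputable def Sp0.value (Y : Sp0 𝓕 P p d) (t : TimeSet T) : LpAt 𝓕 P p d t :=
  Y.1.value t

/-- The value `M_t` of an element of `M^p_0`. -/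
noncomputable def Mp0.value (M : Mp0 𝓕 P p d) (t : TimeSet T) : LpAt 𝓕 P p d t :=
  M.1.value t

/-- The process that is identically zero. -/
def SpProcess.zero (𝓕 : Filtration (TimeSet T) mΩ) (P : Measure Ω) (p : ℝ≥0∞) (d : ℕ) :
    SpProcess 𝓕 P p d where
  path := 0
  adapted _ := stronglyMeasurable_const
  rightContinuous _ _ := tendsto_const_nhds
  leftLimit _ _ := ⟨0, tendsto_const_nhds⟩
  sup_finite := by simp

instance Mp0.instNonempty : Nonempty (Mp0 𝓕 P p d) := by
  refine ⟨⟨(SpProcess.zero 𝓕 P p d).toSp, ⟨SpProcess.zero 𝓕 P p d, rfl,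
    martingale_zero _ 𝓕 P⟩, ?_⟩⟩
  exact Subtype.ext (MemLp.toLp_zero ((SpProcess.zero 𝓕 P p d).memLp (initialTime T)))

end Spaces

section Equation

variable {Ω : Type*} {mΩ : MeasurableSpace Ω} {T : ℝ≥0} {𝓕 : Filtration (TimeSet T) mΩ}
  {P : Measure Ω} {p : ℝ≥0∞} {d : ℕ}

/-- `Y` solves the forward equation `Y_t = y - F_t(Y, M) - M_t` for all `t ∈ [0, T]`. The
identities hold almost surely for each `t`, that is, in `L^p`. -/
def SolvesForward (F : Sp 𝓕 P p d × Mp0 𝓕 P p d → Sp0 𝓕 P p d)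
    (y : LpAt 𝓕 P p d (initialTime T)) (M : Mp0 𝓕 P p d) (Y : Sp 𝓕 P p d) : Prop :=
  ∀ t : TimeSet T, (Y.value t : Lp (EuclideanSpace ℝ (Fin d)) p P) =
    y - (F (Y, M)).value t - M.value t

/-- Condition (S): for all `y ∈ L^p(𝓕_0)^d` and `M ∈ M^p_0`, the equation
`Y_t = y - F_t(Y, M) - M_t`, `t ∈ [0, T]`, has a unique solution `Y ∈ S^p`. -/
def ConditionS (F : Sp 𝓕 P p d × Mp0 𝓕 P p d → Sp0 𝓕 P p d) : Prop :=
  ∀ (y : LpAt 𝓕 P p d (initialTime T)) (M : Mp0 𝓕 P p d), ∃! Y : Sp 𝓕 P p d, SolvesForward F y M Y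

/-- `(Y, M)` solves the backward stochastic equation
`Y_t + F_t(Y, M) + M_t = ξ + F_T(Y, M) + M_T` for all `t ∈ [0, T]`. -/
def SolvesBSE (F : Sp 𝓕 P p d × Mp0 𝓕 P p d → Sp0 𝓕 P p d)
    (ξ : LpAt 𝓕 P p d (terminalTime T)) (Y : Sp 𝓕 P p d) (M : Mp0 𝓕 P p d) : Prop :=
  ∀ t : TimeSet T,
    (Y.value t : Lp (EuclideanSpace ℝ (Fin d)) p P) + (F (Y, M)).value t + M.value t =
      ξ + (F (Y, M)).value (terminalTime T) + M.value (terminalTime T)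

theorem memLp_condExp [IsProbabilityMeasure P] [hp : Fact (1 ≤ p)]
    (V : LpAt 𝓕 P p d (terminalTime T)) (t : TimeSet T) :
    MemLp (P[(V : Lp (EuclideanSpace ℝ (Fin d)) p P) | 𝓕 t]) p P :=
  ⟨(stronglyMeasurable_condExp.mono (𝓕.le t)).aestronglyMeasurable,
    (eLpNorm_condExp_le_eLpNorm _ hp.out).trans_lt (Lp.memLp _).2⟩

/-- The conditional expectation `E_t(V) = E[V | 𝓕_t]`, as a class in `L^p(𝓕_t)^d`. -/
noncomputable def condAt [IsProbabilityMeasure P] [Fact (1 ≤ p)]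
    (V : LpAt 𝓕 P p d (terminalTime T)) (t : TimeSet T) : LpAt 𝓕 P p d t :=
  ⟨(memLp_condExp V t).toLp _, mem_lpMeas_iff_aestronglyMeasurable.mpr
    (stronglyMeasurable_condExp.aestronglyMeasurable.congr
      (memLp_condExp V t).coeFn_toLp.symm)⟩

/-- The martingale `M^V ∈ M^p_0` with `M^V_t = E_0(V) - E_t(V)` for every `t`, as an element of
`M^p_0`. Under the usual conditions and for `1 < p` there is exactly one (the class of an RCLL
version), and it is what the description operator picks. -/
noncomputable def martingaleOf [IsProbabilityMeasure P] [Fact (1 ≤ p)]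
    (V : LpAt 𝓕 P p d (terminalTime T)) : Mp0 𝓕 P p d :=
  Classical.epsilon fun M : Mp0 𝓕 P p d =>
    ∀ t : TimeSet T, (M.value t : Lp (EuclideanSpace ℝ (Fin d)) p P) =
      condAt V (initialTime T) - condAt V t

/-- `Y^V`: the unique solution of `Y_t = E_0(V) - F_t(Y, M^V) - M^V_t`, given by condition (S). -/
noncomputable def solutionOf [IsProbabilityMeasure P] [Fact (1 ≤ p)]
    (F : Sp 𝓕 P p d × Mp0 𝓕 P p d → Sp0 𝓕 P p d) (hS : ConditionS F)
    (V : LpAt 𝓕 P p d (terminalTime T)) : Sp 𝓕 P p d :=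
  (hS (condAt V (initialTime T)) (martingaleOf V)).choose

/-- The operator `G(V) = ξ + F_T(Y^V, M^V)` on `L^p(𝓕_T)^d` determined by `(F, ξ)`. -/
noncomputable def operatorG [IsProbabilityMeasure P] [Fact (1 ≤ p)]
    (F : Sp 𝓕 P p d × Mp0 𝓕 P p d → Sp0 𝓕 P p d) (hS : ConditionS F)
    (ξ V : LpAt 𝓕 P p d (terminalTime T)) : LpAt 𝓕 P p d (terminalTime T) :=
  ξ + (F (solutionOf F hS V, martingaleOf V)).value (terminalTime T)

end Equation

end ClassicalBSE

/-! Any fixed point V of G solves the equation. The forward equation for `Y^V` says that the left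
side of (BSE) equals `E_0(V)` for every t. Since `ξ + F_T = V` and `M^V_T = E_0(V) - V`, the right
side is `E_0(V)` as well. Two facts remain: G has a fixed point, and `M^V` really is an element of
`M^p_0`.

The fixed point comes from `exists_fixedPoint_of_nonexpansive`. Contractions close to the map give
approximate fixed points `x n`. In a uniformly convex space this sequence has a unique asymptotic
center, and nonexpansiveness makes the image of the center another one. Uniform convexity of `L^p`,
`1 < p < ∞`, comes from integrating a pointwise inequality (`exists_norm_sub_rpow_le`) and passes to
the subspace `L^p(𝓕_T)^d`.

The existence of `M^V` (`exists_martingale_value_eq`) is the regularization theorem for martingales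
`E[V | 𝓕 t]`. In the square integrable case an orthogonality argument bounds the expected number of
oscillations along finite sets of times, uniformly in the set. Doob's inequality carries this to
`L^p` by approximation with simple functions, so almost every path along a countable dense set has
one-sided limits. The right limits form the RCLL version: right-continuity of the filtration makes
it adapted, and dominated convergence identifies it with `E[V | 𝓕 t]`. -/

/-! ### Fixed points of nonexpansive maps. -/

/-- A nonexpansive self-map of a nonempty bounded complete convex set has approximate fixed
points. -/
theorem exists_approx_fixedPoint_of_nonexpansive {E : Type*} [NormedAddCommGroup E]
    [NormedSpace ℝ E] {C : Set E} (hne : C.Nonempty) (hb : Bornology.IsBounded C)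
    (hc : IsComplete C) (hconv : Convex ℝ C) {f : E → E} (hf : Set.MapsTo f C C)
    (hne' : ∀ x ∈ C, ∀ y ∈ C, ‖f x - f y‖ ≤ ‖x - y‖) {ε : ℝ} (hε : 0 < ε) :
    ∃ x ∈ C, ‖x - f x‖ < ε := by
  obtain ⟨x₀, hx₀⟩ := hne
  obtain ⟨B, hB⟩ := Metric.isBounded_iff.1 hb
  have hB0 : 0 ≤ B := dist_nonneg.trans (hB hx₀ hx₀)
  obtain ⟨s, hs0, hs1, hsB⟩ : ∃ s : ℝ, 0 < s ∧ s < 1 ∧ s * B < ε := by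
    refine ⟨min (1 / 2) (ε / (2 * (B + 1))), by positivity,
      (min_le_left _ _).trans_lt (by norm_num), ?_⟩
    have h1 : min (1 / 2) (ε / (2 * (B + 1))) * B ≤ ε / (2 * (B + 1)) * B := by
      gcongr; exact min_le_right _ _
    have h2 : ε / (2 * (B + 1)) * B ≤ ε / 2 := by
      rw [div_mul_eq_mul_div, div_le_div_iff₀ (by positivity) (by positivity)]
      nlinarith
    linarith
  -- `g` is a contraction with factor `1 - s`; at its fixed point the defect `x - f x` equals `s •
  -- (x₀ - f x)`, of norm at most `s * B`.
  let g : E → E := fun x => (1 - s) • f x + s • x₀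
  have hg : Set.MapsTo g C C := fun x hx =>
    hconv (hf hx) hx₀ (by linarith) hs0.le (by ring)
  have hK : ContractingWith (Real.toNNReal (1 - s)) (hg.restrict g C C) := by
    refine ⟨by rw [← NNReal.coe_lt_coe, Real.coe_toNNReal _ (by linarith)]; simpa using hs0,
      LipschitzWith.of_dist_le_mul fun x y => ?_⟩
    have : g x - g y = (1 - s) • (f x - f y) := by simp only [g]; module
    rw [Subtype.dist_eq, Subtype.dist_eq, Set.MapsTo.val_restrict_apply,
      Set.MapsTo.val_restrict_apply, dist_eq_norm, this, norm_smul, Real.norm_of_nonneg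
      (by linarith), Real.coe_toNNReal _ (by linarith), dist_eq_norm]
    exact mul_le_mul_of_nonneg_left (hne' _ x.2 _ y.2) (by linarith)
  obtain ⟨x, hxC, hx, -⟩ := hK.exists_fixedPoint' hc hg hx₀ (edist_ne_top _ _)
  refine ⟨x, hxC, ?_⟩
  have h1 : x - f x = s • (x₀ - f x) := by
    have h2 : (1 - s) • f x + s • x₀ = x := hx
    nth_rewrite 1 [← h2]; module
  rw [h1, norm_smul, Real.norm_of_nonneg hs0.le, ← dist_eq_norm]
  exact (mul_le_mul_of_nonneg_left (hB hx₀ (hf hxC)) hs0.le).trans_lt hsB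

/-- **Browder–Göhde–Kirk theorem**: a nonexpansive self-map of a nonempty bounded closed convex
subset of a uniformly convex Banach space has a fixed point. -/
theorem exists_fixedPoint_of_nonexpansive {E : Type*} [NormedAddCommGroup E] [NormedSpace ℝ E]
    [UniformConvexSpace E] [CompleteSpace E] {C : Set E} (hne : C.Nonempty)
    (hb : Bornology.IsBounded C) (hc : IsClosed C) (hconv : Convex ℝ C) {f : E → E}
    (hf : Set.MapsTo f C C) (hne' : ∀ x ∈ C, ∀ y ∈ C, ‖f x - f y‖ ≤ ‖x - y‖) :
    ∃ x ∈ C, f x = x := by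
  have happ : ∀ n : ℕ, ∃ x ∈ C, ‖x - f x‖ < 1 / (n + 1 : ℝ) := fun n =>
    exists_approx_fixedPoint_of_nonexpansive hne hb hc.isComplete hconv hf hne' (by positivity)
  choose x hxC hx using happ
  have hx0 : Tendsto (fun n => ‖x n - f (x n)‖) atTop (𝓝 0) :=
    squeeze_zero (fun _ => norm_nonneg _) (fun n => (hx n).le)
      tendsto_one_div_add_atTop_nhds_zero_nat
  -- `ρ₀` below is the asymptotic radius of the sequence `x` in `C`; the center is the point common
  -- to all `A (ρ₀ + η)`, `η > 0`.
  let A : ℝ → Set E := fun ρ => {y ∈ C | ∀ᶠ n in atTop, ‖x n - y‖ ≤ ρ}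
  have hAmono : ∀ {ρ ρ'}, ρ ≤ ρ' → A ρ ⊆ A ρ' := fun h y hy =>
    ⟨hy.1, hy.2.mono fun _ h' => h'.trans h⟩
  let S : Set ℝ := {ρ | (A ρ).Nonempty}
  have hSnn : ∀ ρ ∈ S, 0 ≤ ρ := by
    rintro ρ ⟨y, -, hy⟩
    obtain ⟨n, hn⟩ := hy.exists
    exact (norm_nonneg _).trans hn
  have hSbdd : BddBelow S := ⟨0, hSnn⟩
  have hSne : S.Nonempty := by
    obtain ⟨x₀, hx₀⟩ := hne
    obtain ⟨B, hB⟩ := Metric.isBounded_iff.1 hb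
    exact ⟨B, x₀, hx₀, .of_forall fun n => by rw [← dist_eq_norm]; exact hB (hxC n) hx₀⟩
  set ρ₀ := sInf S with hρ₀
  have hρ₀nn : 0 ≤ ρ₀ := le_csInf hSne hSnn
  have hAne : ∀ η > 0, (A (ρ₀ + η)).Nonempty := fun η hη => by
    obtain ⟨ρ, hρ, hlt⟩ := exists_lt_of_csInf_lt hSne (lt_add_of_pos_right ρ₀ hη)
    exact hρ.mono (hAmono hlt.le)
  have hAempty : ∀ ρ < ρ₀, ¬ (A ρ).Nonempty := fun ρ hρ h => (not_le.2 hρ) (csInf_le hSbdd h)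
  -- If two points of `A (ρ₀ + η)` were `ε` apart, uniform convexity would put their midpoint in `A
  -- ρ` for some `ρ < ρ₀`, which is empty. This needs `ρ₀ > 0`; for `ρ₀ = 0` the triangle inequality
  -- is enough.
  have hdiam : ∀ ε > 0, ∃ η > 0, ∀ y ∈ A (ρ₀ + η), ∀ z ∈ A (ρ₀ + η), ‖y - z‖ < ε := by
    intro ε hε
    rcases hρ₀nn.eq_or_lt with h0 | hpos
    · refine ⟨ε / 3, by positivity, fun y hy z hz => ?_⟩
      obtain ⟨n, hn, hn'⟩ := (hy.2.and hz.2).exists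
      have : y - z = (x n - z) - (x n - y) := by abel
      rw [this]
      refine (norm_sub_le _ _).trans_lt ?_
      rw [← h0] at hn hn'
      linarith
    -- As `η ≤ 1`, a distance of at least `ε` is still at least `ε / (ρ₀ + 1)` after division by `ρ₀
    -- + η`.
    obtain ⟨δ, hδ, hu⟩ := exists_forall_closed_ball_dist_add_le_two_sub E
      (show 0 < ε / (ρ₀ + 1) by positivity)
    obtain ⟨η, hη0, hη1, hη⟩ : ∃ η : ℝ, 0 < η ∧ η ≤ 1 ∧ (ρ₀ + η) * (2 - δ) / 2 < ρ₀ := by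
      have hcont : Tendsto (fun η : ℝ => (ρ₀ + η) * (2 - δ) / 2) (𝓝[>] 0)
          (𝓝 ((ρ₀ + 0) * (2 - δ) / 2)) := by
        refine Tendsto.mono_left (Continuous.tendsto ?_ _) nhdsWithin_le_nhds
        fun_prop
      have h1 := hcont.eventually_lt_const (show (ρ₀ + 0) * (2 - δ) / 2 < ρ₀ by nlinarith)
      obtain ⟨η, h⟩ := (h1.and (Ioc_mem_nhdsGT (zero_lt_one' ℝ))).exists
      exact ⟨η, h.2.1, h.2.2, h.1⟩
    refine ⟨η, hη0, fun y hy z hz => ?_⟩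
    by_contra! hyz
    have hr : 0 < ρ₀ + η := by positivity
    refine hAempty _ hη ⟨(1 / 2 : ℝ) • y + (1 / 2 : ℝ) • z,
      hconv hy.1 hz.1 (by norm_num) (by norm_num) (by norm_num), ?_⟩
    filter_upwards [hy.2, hz.2] with n hny hnz
    have hscale : ∀ v : E, ‖(ρ₀ + η)⁻¹ • v‖ = ‖v‖ / (ρ₀ + η) := fun v => by
      rw [norm_smul, norm_inv, Real.norm_of_nonneg hr.le, inv_mul_eq_div]
    have key := hu (x := (ρ₀ + η)⁻¹ • (x n - y)) (by rw [hscale]; exact (div_le_one hr).2 hny)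
      (y := (ρ₀ + η)⁻¹ • (x n - z)) (by rw [hscale]; exact (div_le_one hr).2 hnz) (by
        rw [← smul_sub, hscale, sub_sub_sub_cancel_left, norm_sub_rev]
        gcongr)
    rw [← smul_add, hscale, div_le_iff₀ hr] at key
    have h2 : x n - ((1 / 2 : ℝ) • y + (1 / 2 : ℝ) • z) =
        (1 / 2 : ℝ) • ((x n - y) + (x n - z)) := by module
    rw [h2, norm_smul, Real.norm_of_nonneg (by norm_num)]
    linarith
  choose y hy using fun k : ℕ => hAne (1 / (k + 1 : ℝ)) (by positivity)
  have hcau : CauchySeq y := by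
    refine Metric.cauchySeq_iff.2 fun ε hε => ?_
    obtain ⟨η, hη, h⟩ := hdiam ε hε
    obtain ⟨N, hN⟩ := exists_nat_one_div_lt hη
    have hmem : ∀ k ≥ N, y k ∈ A (ρ₀ + η) := fun k hk => by
      refine hAmono ?_ (hy k)
      have := Nat.one_div_le_one_div (α := ℝ) hk
      linarith
    exact ⟨N, fun m hm n hn => by rw [dist_eq_norm]; exact h _ (hmem m hm) _ (hmem n hn)⟩
  obtain ⟨z, hz⟩ := cauchySeq_tendsto_of_complete hcau
  have hzC : z ∈ C := hc.mem_of_tendsto hz (.of_forall fun k => (hy k).1)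
  have hzA : ∀ η > 0, z ∈ A (ρ₀ + η) := by
    intro η hη
    obtain ⟨k, hk, hk'⟩ := (((tendsto_iff_norm_sub_tendsto_zero.1 hz).eventually_lt_const
      (half_pos hη)).and (tendsto_one_div_add_atTop_nhds_zero_nat.eventually_lt_const
      (half_pos hη))).exists
    refine ⟨hzC, (hy k).2.mono fun n hn => ?_⟩
    have : x n - z = (x n - y k) + (y k - z) := by abel
    rw [this]
    refine (norm_add_le _ _).trans ?_
    linarith
  -- `f z` is as close to `f (x n)` as `z` is to `x n`, and `f (x n)` is asymptotically `x n`.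
  have hfzA : ∀ η > 0, f z ∈ A (ρ₀ + η) := by
    intro η hη
    refine ⟨hf hzC, ?_⟩
    filter_upwards [(hzA _ (half_pos hη)).2, hx0.eventually_lt_const (half_pos hη)] with n h1 h2
    have : x n - f z = (x n - f (x n)) + (f (x n) - f z) := by abel
    rw [this]
    refine (norm_add_le _ _).trans ?_
    have := hne' _ (hxC n) _ hzC
    linarith
  refine ⟨z, hzC, ?_⟩
  rw [← sub_eq_zero, ← norm_le_zero_iff]
  refine le_of_forall_pos_le_add fun ε hε => ?_
  obtain ⟨η, hη, h⟩ := hdiam ε hε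
  have := h _ (hfzA η hη) _ (hzA η hη)
  linarith

/-! ### Uniform convexity of `L^p`. -/

section UniformConvexity

variable {E : Type*} [NormedAddCommGroup E] [NormedSpace ℝ E]

theorem norm_half_smul_add_rpow_le {r : ℝ} (hr : 1 ≤ r) (a b : E) :
    ‖(1 / 2 : ℝ) • (a + b)‖ ^ r ≤ (‖a‖ ^ r + ‖b‖ ^ r) / 2 := by
  have h1 : ‖(1 / 2 : ℝ) • (a + b)‖ ≤ (1 / 2 : ℝ) • ‖a‖ + (1 / 2 : ℝ) • ‖b‖ := by
    rw [norm_smul, Real.norm_of_nonneg (by norm_num), smul_eq_mul, smul_eq_mul, ← mul_add]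
    gcongr
    exact norm_add_le _ _
  refine (Real.rpow_le_rpow (norm_nonneg _) h1 (by linarith)).trans ?_
  refine ((convexOn_rpow hr).2 (norm_nonneg a) (norm_nonneg b) (by norm_num) (by norm_num)
    (by norm_num)).trans ?_
  simp only [smul_eq_mul]
  linarith

/-- Strict convexity of `t ↦ t ^ r` forces `‖a‖ = ‖b‖`; then the triangle inequality is an equality,
and strict convexity of the norm gives the rest. -/
theorem eq_of_norm_half_smul_add_rpow_eq [StrictConvexSpace ℝ E] {r : ℝ} (hr : 1 < r) {a b : E}
    (h : (‖a‖ ^ r + ‖b‖ ^ r) / 2 ≤ ‖(1 / 2 : ℝ) • (a + b)‖ ^ r) : a = b := by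
  have h1 : ‖(1 / 2 : ℝ) • (a + b)‖ = (1 / 2 : ℝ) * ‖a + b‖ := by
    rw [norm_smul, Real.norm_of_nonneg (by norm_num)]
  have h2 : ‖(1 / 2 : ℝ) • (a + b)‖ ≤ (1 / 2 : ℝ) • ‖a‖ + (1 / 2 : ℝ) • ‖b‖ := by
    rw [h1, smul_eq_mul, smul_eq_mul, ← mul_add]
    gcongr
    exact norm_add_le _ _
  have hab : ‖a‖ = ‖b‖ := by
    by_contra hne
    have h3 := (strictConvexOn_rpow hr).2 (norm_nonneg a) (norm_nonneg b) hne
      (show (0 : ℝ) < 1 / 2 by norm_num) (show (0 : ℝ) < 1 / 2 by norm_num) (by norm_num)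
    have h4 := Real.rpow_le_rpow (norm_nonneg _) h2 (show 0 ≤ r by linarith)
    simp only [smul_eq_mul] at h3 h4
    linarith
  refine eq_of_norm_eq_of_norm_add_eq hab (le_antisymm (norm_add_le _ _) ?_)
  have h5 : ‖b‖ ^ r ≤ ‖(1 / 2 : ℝ) • (a + b)‖ ^ r := by
    refine le_trans (le_of_eq ?_) h
    rw [hab]; ring
  have h6 := (Real.rpow_le_rpow_iff (norm_nonneg _) (norm_nonneg _) (by linarith)).1 h5
  rw [h1] at h6
  rw [hab]
  linarith

/-- A quantitative form of the strict convexity of `‖·‖ ^ r`. -/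
theorem exists_norm_sub_rpow_le [ProperSpace E] [StrictConvexSpace ℝ E] {r : ℝ} (hr : 1 < r)
    {ε : ℝ} (hε : 0 < ε) : ∃ K : ℝ, 0 ≤ K ∧ ∀ a b : E, ‖a - b‖ ^ r ≤ ε * (‖a‖ ^ r + ‖b‖ ^ r) +
      K * ((‖a‖ ^ r + ‖b‖ ^ r) / 2 - ‖(1 / 2 : ℝ) • (a + b)‖ ^ r) := by
  have hr0 : 0 < r := by linarith
  let φ : E × E → ℝ := fun z => ‖z.1 - z.2‖ ^ r - ε * (‖z.1‖ ^ r + ‖z.2‖ ^ r)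
  let ψ : E × E → ℝ := fun z => (‖z.1‖ ^ r + ‖z.2‖ ^ r) / 2 - ‖(1 / 2 : ℝ) • (z.1 + z.2)‖ ^ r
  have hφ : Continuous φ := by
    refine ((by fun_prop : Continuous fun z : E × E => ‖z.1 - z.2‖).rpow_const
      fun _ => .inr hr0.le).sub (continuous_const.mul ?_)
    exact (continuous_fst.norm.rpow_const fun _ => .inr hr0.le).add
      (continuous_snd.norm.rpow_const fun _ => .inr hr0.le)
  have hψ : Continuous ψ := by
    refine Continuous.sub (Continuous.div_const ?_ 2) (Continuous.rpow_const (by fun_prop)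
      fun _ => .inr hr0.le)
    exact (continuous_fst.norm.rpow_const fun _ => .inr hr0.le).add
      (continuous_snd.norm.rpow_const fun _ => .inr hr0.le)
  have hψ0 : ∀ z, 0 ≤ ψ z := fun z => sub_nonneg.2 (norm_half_smul_add_rpow_le hr.le _ _)
  -- Where `φ ≥ 0` on the unit sphere, `ψ` cannot vanish: `ψ = 0` forces `a = b`, and then `φ = -2 *
  -- ε`. By compactness `K = max φ / min ψ` works there; where `φ < 0` nothing is needed.
  have hcomp : IsCompact (Metric.sphere (0 : E × E) 1 ∩ {z | 0 ≤ φ z}) :=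
    (isCompact_sphere _ _).inter_right (isClosed_le continuous_const hφ)
  have hpos : ∀ z ∈ Metric.sphere (0 : E × E) 1 ∩ {z | 0 ≤ φ z}, 0 < ψ z := by
    rintro z ⟨hz1, hz2⟩
    refine lt_of_le_of_ne (hψ0 z) fun h0 => ?_
    have hz : z.1 = z.2 := eq_of_norm_half_smul_add_rpow_eq hr (sub_nonpos.1 h0.ge)
    have hz3 : ‖z.2‖ = 1 := by
      have := mem_sphere_zero_iff_norm.1 hz1
      rwa [Prod.norm_def, hz, max_self] at this
    have hz4 : 0 ≤ φ z := hz2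
    simp only [φ, hz, sub_self, norm_zero, Real.zero_rpow hr0.ne', hz3, Real.one_rpow] at hz4
    linarith
  obtain ⟨K, hK0, hK⟩ : ∃ K : ℝ, 0 ≤ K ∧
      ∀ z ∈ Metric.sphere (0 : E × E) 1, φ z ≤ K * ψ z := by
    rcases (Metric.sphere (0 : E × E) 1 ∩ {z | 0 ≤ φ z}).eq_empty_or_nonempty with he | hne
    · refine ⟨0, le_rfl, fun z hz => ?_⟩
      by_contra! h
      exact (he.le ⟨hz, by simpa using h.le⟩ : z ∈ (∅ : Set (E × E))).elim
    · obtain ⟨z₀, hz₀, hmin⟩ := hcomp.exists_isMinOn hne hψ.continuousOn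
      obtain ⟨z₁, hz₁, hmax⟩ := hcomp.exists_isMaxOn hne hφ.continuousOn
      refine ⟨φ z₁ / ψ z₀, div_nonneg hz₁.2 (hψ0 _), fun z hz => ?_⟩
      rcases lt_or_ge (φ z) 0 with h | h
      · exact h.le.trans (mul_nonneg (div_nonneg hz₁.2 (hψ0 _)) (hψ0 _))
      · rw [div_mul_eq_mul_div, le_div_iff₀ (hpos _ hz₀)]
        exact mul_le_mul (hmax ⟨hz, h⟩) (hmin ⟨hz, h⟩) (hψ0 _) hz₁.2
  refine ⟨K, hK0, fun a b => ?_⟩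
  -- Both sides are homogeneous of degree `r`, so the general case reduces to the sphere.
  rcases eq_or_ne ((a, b) : E × E) 0 with h0 | h0
  · obtain ⟨rfl, rfl⟩ := Prod.mk_eq_zero.1 h0
    simp [Real.zero_rpow hr0.ne']
  · set c := ‖((a, b) : E × E)‖ with hc
    have hc0 : 0 < c := norm_pos_iff.2 h0
    have hsc : ∀ v : E, ‖c⁻¹ • v‖ ^ r = (c ^ r)⁻¹ * ‖v‖ ^ r := fun v => by
      rw [norm_smul, norm_inv, Real.norm_of_nonneg hc0.le, Real.mul_rpow (by positivity)
        (norm_nonneg _), Real.inv_rpow hc0.le]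
    have := hK (c⁻¹ • (a, b)) (by
      rw [mem_sphere_zero_iff_norm, norm_smul, norm_inv, Real.norm_of_nonneg hc0.le, ← hc,
        inv_mul_cancel₀ hc0.ne'])
    simp only [φ, ψ, Prod.smul_mk, ← smul_sub, ← smul_add] at this
    rw [smul_comm, hsc, hsc, hsc, hsc] at this
    have hcr : 0 < c ^ r := Real.rpow_pos_of_pos hc0 r
    have h3 := mul_le_mul_of_nonneg_left this hcr.le
    have hi : c ^ r * (c ^ r)⁻¹ = 1 := mul_inv_cancel₀ hcr.ne'
    have e1 : c ^ r * ((c ^ r)⁻¹ * ‖a - b‖ ^ r - ε * ((c ^ r)⁻¹ * ‖a‖ ^ r + (c ^ r)⁻¹ * ‖b‖ ^ r)) =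
      (c ^ r * (c ^ r)⁻¹) * (‖a - b‖ ^ r - ε * (‖a‖ ^ r + ‖b‖ ^ r)) := by ring
    have e2 : c ^ r * (K * (((c ^ r)⁻¹ * ‖a‖ ^ r + (c ^ r)⁻¹ * ‖b‖ ^ r) / 2 -
        (c ^ r)⁻¹ * ‖(1 / 2 : ℝ) • (a + b)‖ ^ r)) = (c ^ r * (c ^ r)⁻¹) *
        (K * ((‖a‖ ^ r + ‖b‖ ^ r) / 2 - ‖(1 / 2 : ℝ) • (a + b)‖ ^ r)) := by ring
    rw [e1, e2, hi, one_mul, one_mul] at h3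
    linarith

variable {α : Type*} {mα : MeasurableSpace α} {μ : Measure α} {p : ℝ≥0∞}

theorem MeasureTheory.Lp.norm_rpow_toReal_eq_integral {E : Type*} [NormedAddCommGroup E]
    (hp0 : p ≠ 0) (hp : p ≠ ∞)
    (f : Lp E p μ) :    ‖f‖ ^ p.toReal = ∫ x, ‖f x‖ ^ p.toReal ∂μ := by
  have h0 : 0 < p.toReal := ENNReal.toReal_pos hp0 hp
  rw [Lp.norm_def, (Lp.memLp f).eLpNorm_eq_integral_rpow_norm hp0 hp,
    ENNReal.toReal_ofReal (by positivity), ← Real.rpow_mul (by positivity),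
    inv_mul_cancel₀ h0.ne', Real.rpow_one]

/-- The spaces `L^p`, `1 < p < ∞`, are uniformly convex. -/
theorem MeasureTheory.Lp.uniformConvexSpace [ProperSpace E] [StrictConvexSpace ℝ E]
    [Fact (1 ≤ p)] (hp_one : 1 < p) (hp_top : p ≠ ∞) : UniformConvexSpace (Lp E p μ) := by
  have hp0 : p ≠ 0 := (zero_lt_one.trans hp_one).ne'
  have hr : 1 < p.toReal := by
    rw [← ENNReal.toReal_one]; exact (ENNReal.toReal_lt_toReal (by simp) hp_top).2 hp_one
  set r := p.toReal with hr_def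
  have hr0 : 0 < r := by linarith
  refine ⟨fun ε hε => ?_⟩
  have hεr : 0 < ε ^ r := Real.rpow_pos_of_pos hε r
  -- For unit vectors the first term contributes `ε ^ r / 2`, so half of `‖f - g‖ ^ r ≥ ε ^ r` is
  -- left for the midpoint deficit. `K + 1` is used as a divisor because `K` may be zero.
  obtain ⟨K, hK0, hK⟩ := exists_norm_sub_rpow_le (E := E) hr (show 0 < ε ^ r / 4 by positivity)
  refine ⟨ε ^ r / (K + 1) / r, by positivity, fun f hf g hg hfg => ?_⟩
  have hint : ∀ h : Lp E p μ, Integrable (fun x => ‖h x‖ ^ r) μ := fun h =>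
    (Lp.memLp h).integrable_norm_rpow hp0 hp_top
  have hnorm := fun h : Lp E p μ => Lp.norm_rpow_toReal_eq_integral hp0 hp_top h
  have key : ‖f - g‖ ^ r ≤ ε ^ r / 4 * (‖f‖ ^ r + ‖g‖ ^ r) +
      K * ((‖f‖ ^ r + ‖g‖ ^ r) / 2 - ‖(1 / 2 : ℝ) • (f + g)‖ ^ r) := by
    have hs : Integrable (fun x => ‖f x‖ ^ r + ‖g x‖ ^ r) μ := (hint f).add (hint g)
    have hd : Integrable (fun x => (‖f x‖ ^ r + ‖g x‖ ^ r) / 2 -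
        ‖((1 / 2 : ℝ) • (f + g) : Lp E p μ) x‖ ^ r) μ := (hs.div_const 2).sub (hint _)
    have hrhs : ∫ x, (ε ^ r / 4 * (‖f x‖ ^ r + ‖g x‖ ^ r) + K * ((‖f x‖ ^ r + ‖g x‖ ^ r) / 2 -
        ‖((1 / 2 : ℝ) • (f + g) : Lp E p μ) x‖ ^ r)) ∂μ = ε ^ r / 4 * (‖f‖ ^ r + ‖g‖ ^ r) +
        K * ((‖f‖ ^ r + ‖g‖ ^ r) / 2 - ‖(1 / 2 : ℝ) • (f + g)‖ ^ r) := by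
      rw [integral_add (hs.const_mul _) (hd.const_mul _), integral_const_mul, integral_const_mul,
        integral_sub (hs.div_const 2) (hint _), integral_div, integral_add (hint f) (hint g),
        ← hnorm, ← hnorm, ← hnorm]
    rw [← hrhs, hnorm]
    refine integral_mono_ae (hint _) ((hs.const_mul _).add (hd.const_mul _)) ?_
    filter_upwards [Lp.coeFn_sub f g, Lp.coeFn_smul (1 / 2 : ℝ) (f + g), Lp.coeFn_add f g]
      with x h1 h2 h3
    simp only [h1, h2, h3, Pi.sub_apply, Pi.smul_apply, Pi.add_apply]
    exact hK _ _
  have h1 : ε ^ r ≤ ‖f - g‖ ^ r := Real.rpow_le_rpow hε.le hfg hr0.le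
  rw [hf, hg, Real.one_rpow, norm_smul, Real.norm_of_nonneg (by norm_num)] at key
  set t := (1 / 2 : ℝ) * ‖f + g‖ with ht
  -- Bernoulli's inequality makes the deficit `1 - t ^ r` linear in `1 - t`.
  have hb : 1 + r * (t - 1) ≤ t ^ r := by
    have := one_add_mul_self_le_rpow_one_add (s := t - 1)
      (by rw [ht]; linarith [norm_nonneg (f + g)])
      hr.le
    simpa using this
  have h2 : ε ^ r / 2 ≤ (K + 1) * (r * (1 - t)) := by
    have hs1 : 0 ≤ 1 - t := by
      have := norm_add_le f g
      rw [hf, hg] at this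
      rw [ht]; linarith
    have h3 : K * ((1 + 1) / 2 - t ^ r) ≤ K * (r * (1 - t)) := by
      gcongr; linarith
    nlinarith [mul_nonneg hr0.le hs1]
  have h4 : ε ^ r / (K + 1) / r ≤ 2 * (1 - t) := by
    rw [div_le_iff₀ hr0, div_le_iff₀ (by positivity)]
    nlinarith
  rw [ht] at h4
  linarith

end UniformConvexity

theorem Submodule.uniformConvexSpace {E : Type*} [NormedAddCommGroup E] [NormedSpace ℝ E]
    (h : UniformConvexSpace E) (S : Submodule ℝ E) : UniformConvexSpace S :=
  ⟨fun _ hε => (h.uniform_convex hε).imp fun _ hδ =>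
    ⟨hδ.1, fun _ hx _ hy hxy => hδ.2 hx hy hxy⟩⟩

/-! ### Doob's maximal inequality in discrete time. -/

section Doob

theorem MeasureTheory.Martingale.norm_le_condExp_norm {ι Ω E : Type*} [Preorder ι]
    {mΩ : MeasurableSpace Ω} {P : Measure Ω} [NormedAddCommGroup E] [NormedSpace ℝ E]
    [CompleteSpace E] {𝓕 : Filtration ι mΩ} {Y : ι → Ω → E} (hY : Martingale Y 𝓕 P) {i j : ι}
    (hij : i ≤ j) : (fun ω => ‖Y i ω‖) ≤ᵐ[P] P[fun ω => ‖Y j ω‖ | 𝓕 i] := by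
  filter_upwards [hY.condExp_ae_eq hij, norm_condExp_le (μ := P) (m := 𝓕 i) (Y j)] with ω h1 h2
  rwa [h1] at h2

theorem MeasureTheory.Martingale.integral_mul_norm_le {ι Ω E : Type*} [Preorder ι]
    {mΩ : MeasurableSpace Ω} {P : Measure Ω} [IsFiniteMeasure P] [NormedAddCommGroup E]
    [NormedSpace ℝ E] [CompleteSpace E] {𝓕 : Filtration ι mΩ} {Y : ι → Ω → E}
    (hY : Martingale Y 𝓕 P) {i j : ι} (hij : i ≤ j) {f : Ω → ℝ}
    (hf : StronglyMeasurable[𝓕 i] f) (hf0 : ∀ ω, 0 ≤ f ω)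
    (hi : Integrable (fun ω => f ω * ‖Y i ω‖) P) (hj : Integrable (fun ω => f ω * ‖Y j ω‖) P) :
    ∫ ω, f ω * ‖Y i ω‖ ∂P ≤ ∫ ω, f ω * ‖Y j ω‖ ∂P := by
  have h := condExp_mul_of_stronglyMeasurable_left (μ := P) hf hj (hY.integrable j).norm
  rw [← integral_condExp (𝓕.le i) (f := fun ω => f ω * ‖Y j ω‖)]
  refine integral_mono_ae hi integrable_condExp ?_
  filter_upwards [h, hY.norm_le_condExp_norm hij] with ω h1 h2
  refine le_of_le_of_eq ?_ h1.symm
  exact mul_le_mul_of_nonneg_left h2 (hf0 ω)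

variable {Ω E : Type*} [NormedAddCommGroup E]

/-- The running maximum of the norms of a sequence of functions. -/
noncomputable def runningMax (Y : ℕ → Ω → E) : ℕ → Ω → ℝ
  | 0, ω => ‖Y 0 ω‖
  | n + 1, ω => max (runningMax Y n ω) ‖Y (n + 1) ω‖

theorem norm_le_runningMax (Y : ℕ → Ω → E) (ω : Ω) {k n : ℕ} (h : k ≤ n) :
    ‖Y k ω‖ ≤ runningMax Y n ω := by
  induction n with
  | zero => obtain rfl : k = 0 := by omega
            exact le_rfl
  | succ n ih =>
    rcases h.eq_or_lt with rfl | h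
    · exact le_max_right _ _
    · exact (ih (by omega)).trans (le_max_left _ _)

theorem runningMax_nonneg (Y : ℕ → Ω → E) (n : ℕ) (ω : Ω) : 0 ≤ runningMax Y n ω :=
  (norm_nonneg _).trans (norm_le_runningMax Y ω n.zero_le)

/-- The left side is the tangent line at `s` of the convex function `z ↦ z ^ p`. -/
theorem Real.mul_rpow_sub_one_mul_le {p : ℝ} (hp : 1 < p) {s z : ℝ} (hs : 0 ≤ s) (hz : 0 ≤ z) :
    p * (s ^ (p - 1) * z) - (p - 1) * s ^ p ≤ z ^ p := by
  rcases hs.eq_or_lt with rfl | hs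
  · rw [Real.zero_rpow (by linarith), Real.zero_rpow (by linarith)]
    simpa using Real.rpow_nonneg hz p
  · have h := one_add_mul_self_le_rpow_one_add (s := z / s - 1)
      (by linarith [div_nonneg hz hs.le]) hp.le
    rw [add_sub_cancel, Real.div_rpow hz hs.le, le_div_iff₀ (Real.rpow_pos_of_pos hs p)] at h
    refine le_trans (le_of_eq ?_) h
    rw [Real.rpow_sub_one hs.ne']
    field_simp
    ring

/-- The constant in our form of Doob's `L^p` inequality. -/
noncomputable def doobConst (p : ℝ) : ℝ := 2 * (p * (2 * p / (p - 1)) ^ (p - 1)) / (p - 1)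

theorem doobConst_nonneg {p : ℝ} (hp : 1 < p) : 0 ≤ doobConst p := by
  have : 0 < p - 1 := by linarith
  have : 0 < p := by linarith
  unfold doobConst
  positivity

/-- A Young inequality whose weight on `s ^ p` is half of `p - 1`, so that this term can later be
absorbed. The case split is at `z = (p - 1) / (2 * p) * s`; below it the first term suffices, above
it the second. -/
theorem Real.mul_rpow_sub_one_mul_le_add {p : ℝ} (hp : 1 < p) {s z : ℝ} (hs : 0 ≤ s)
    (hz : 0 ≤ z) :
    p * (s ^ (p - 1) * z) ≤ (p - 1) / 2 * s ^ p + (p - 1) / 2 * (doobConst p * z ^ p) := by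
  have hp1 : 0 < p - 1 := by linarith
  have hp0 : 0 < p := by linarith
  have hC : (p - 1) / 2 * (doobConst p * z ^ p) = p * ((2 * p / (p - 1)) ^ (p - 1) * z ^ p) := by
    unfold doobConst
    field_simp
  have hsp : s ^ (p - 1) * s = s ^ p := by
    rw [← Real.rpow_add_one' hs (by linarith), sub_add_cancel]
  have hzp : z ^ (p - 1) * z = z ^ p := by
    rw [← Real.rpow_add_one' hz (by linarith), sub_add_cancel]
  rw [hC]
  rcases le_total z ((p - 1) / (2 * p) * s) with h | h
  · have h1 : p * (s ^ (p - 1) * z) ≤ p * (s ^ (p - 1) * ((p - 1) / (2 * p) * s)) := by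
      gcongr
    have h2 : p * (s ^ (p - 1) * ((p - 1) / (2 * p) * s)) = (p - 1) / 2 * (s ^ (p - 1) * s) := by
      field_simp
    rw [h2, hsp] at h1
    have : 0 ≤ p * ((2 * p / (p - 1)) ^ (p - 1) * z ^ p) := by positivity
    linarith
  · have h1 : s ≤ 2 * p / (p - 1) * z := by
      calc s = 2 * p / (p - 1) * ((p - 1) / (2 * p) * s) := by field_simp
        _ ≤ _ := by gcongr
    have h2 : s ^ (p - 1) ≤ (2 * p / (p - 1)) ^ (p - 1) * z ^ (p - 1) := by
      rw [← Real.mul_rpow (by positivity) hz]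
      exact Real.rpow_le_rpow hs h1 hp1.le
    have h3 : p * (s ^ (p - 1) * z) ≤ p * ((2 * p / (p - 1)) ^ (p - 1) * z ^ (p - 1) * z) := by
      gcongr
    rw [mul_assoc, hzp] at h3
    have : 0 ≤ (p - 1) / 2 * s ^ p := by positivity
    linarith

variable {mΩ : MeasurableSpace Ω} {P : Measure Ω}

theorem stronglyMeasurable_runningMax {𝓕 : Filtration ℕ mΩ} {Y : ℕ → Ω → E}
    (hY : StronglyAdapted 𝓕 Y) (n : ℕ) : StronglyMeasurable[𝓕 n] (runningMax Y n) := by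
  induction n with
  | zero => exact (hY 0).norm
  | succ n ih =>
    have h : StronglyMeasurable[𝓕 (n + 1)] (runningMax Y n) := ih.mono (𝓕.mono n.le_succ)
    exact continuous_max.comp_stronglyMeasurable (h.prodMk (hY (n + 1)).norm)

theorem integrable_runningMax_rpow {𝓕 : Filtration ℕ mΩ} {Y : ℕ → Ω → E}
    (hY : StronglyAdapted 𝓕 Y) {p : ℝ} (hp : 0 < p)
    (hint : ∀ k, Integrable (fun ω => ‖Y k ω‖ ^ p) P) (n : ℕ) :
    Integrable (fun ω => runningMax Y n ω ^ p) P := by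
  induction n with
  | zero => exact hint 0
  | succ n ih =>
    refine (ih.add (hint (n + 1))).mono' ((Real.continuous_rpow_const hp.le).comp_stronglyMeasurable
      ((stronglyMeasurable_runningMax hY (n + 1)).mono (𝓕.le _))).aestronglyMeasurable
      (.of_forall fun ω => ?_)
    have h1 := Real.rpow_nonneg (runningMax_nonneg Y n ω) p
    have h2 := Real.rpow_nonneg (norm_nonneg (Y (n + 1) ω)) p
    rw [Real.norm_of_nonneg (Real.rpow_nonneg (runningMax_nonneg Y _ ω) p)]
    rcases max_choice (runningMax Y n ω) ‖Y (n + 1) ω‖ with h | h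
    · simp only [runningMax, h, Pi.add_apply]; linarith
    · simp only [runningMax, h, Pi.add_apply]; linarith

theorem integrable_runningMax_mul_norm {𝓕 : Filtration ℕ mΩ} {Y : ℕ → Ω → E}
    (hY : StronglyAdapted 𝓕 Y) {p : ℝ} (hp : 1 < p)
    (hint : ∀ k, Integrable (fun ω => ‖Y k ω‖ ^ p) P) {k n m : ℕ} (hk : k ≤ m) (hn : n ≤ m) :
    Integrable (fun ω => runningMax Y n ω ^ (p - 1) * ‖Y k ω‖) P := by
  have hmono : ∀ ω, runningMax Y n ω ≤ runningMax Y m ω := fun ω => by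
    have : Monotone fun n => runningMax Y n ω := monotone_nat_of_le_succ fun n => le_max_left _ _
    exact this hn
  refine (integrable_runningMax_rpow hY (by linarith) hint m).mono'
    (((Real.continuous_rpow_const (by linarith)).comp_stronglyMeasurable
      ((stronglyMeasurable_runningMax hY n).mono (𝓕.le _))).mul
      ((hY k).mono (𝓕.le _)).norm).aestronglyMeasurable (.of_forall fun ω => ?_)
  have h0 := runningMax_nonneg Y m ω
  have h0' := runningMax_nonneg Y n ω
  rw [Real.norm_of_nonneg (by positivity), ← sub_add_cancel p 1,
    Real.rpow_add_one' h0 (by linarith), add_sub_cancel_right]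
  exact mul_le_mul (Real.rpow_le_rpow h0' (hmono ω) (by linarith)) (norm_le_runningMax Y ω hk)
    (norm_nonneg _) (by positivity)

/-- **Doob's `L^p` inequality** for vector-valued martingales in discrete time. -/
theorem MeasureTheory.Martingale.integral_runningMax_rpow_le [NormedSpace ℝ E] [CompleteSpace E]
    [IsFiniteMeasure P] {𝓕 : Filtration ℕ mΩ} {Y : ℕ → Ω → E} (hY : Martingale Y 𝓕 P) {p : ℝ}
    (hp : 1 < p) (hint : ∀ k, Integrable (fun ω => ‖Y k ω‖ ^ p) P) (n : ℕ) :
    ∫ ω, runningMax Y n ω ^ p ∂P ≤ doobConst p * ∫ ω, ‖Y n ω‖ ^ p ∂P := by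
  have hp0 : 0 < p := by linarith
  have hp1 : 0 < p - 1 := by linarith
  have hSp := integrable_runningMax_rpow hY.1 hp0 hint
  have hSY : ∀ {k n m : ℕ}, k ≤ m → n ≤ m →
      Integrable (fun ω => runningMax Y n ω ^ (p - 1) * ‖Y k ω‖) P :=
    integrable_runningMax_mul_norm hY.1 hp hint
  -- This quantity is nondecreasing in `n`: replacing `‖Y n‖` by `‖Y (n + 1)‖` uses the
  -- submartingale property, and updating the maximum changes the integrand only where the new norm
  -- is the maximum, where the tangent line inequality applies.
  have hA : ∀ n, 0 ≤ p * ∫ ω, runningMax Y n ω ^ (p - 1) * ‖Y n ω‖ ∂P -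
      (p - 1) * ∫ ω, runningMax Y n ω ^ p ∂P := by
    intro n
    induction n with
    | zero =>
      have h1 : ∀ ω, runningMax Y 0 ω ^ (p - 1) * ‖Y 0 ω‖ = runningMax Y 0 ω ^ p := fun ω => by
        simp only [runningMax]
        rw [← Real.rpow_add_one' (norm_nonneg _) (by linarith), sub_add_cancel]
      simp only [h1]
      have h2 : 0 ≤ ∫ ω, runningMax Y 0 ω ^ p ∂P :=
        integral_nonneg fun ω => Real.rpow_nonneg (runningMax_nonneg Y 0 ω) p
      linarith
    | succ n ih =>
      refine ih.trans ?_
      have h1 : ∫ ω, runningMax Y n ω ^ (p - 1) * ‖Y n ω‖ ∂P ≤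
          ∫ ω, runningMax Y n ω ^ (p - 1) * ‖Y (n + 1) ω‖ ∂P :=
        hY.integral_mul_norm_le n.le_succ
          ((Real.continuous_rpow_const hp1.le).comp_stronglyMeasurable
          (stronglyMeasurable_runningMax hY.1 n))
          (fun ω => Real.rpow_nonneg (runningMax_nonneg Y n ω) _) (hSY le_rfl le_rfl)
          (hSY le_rfl n.le_succ)
      have h2 : p * ∫ ω, runningMax Y n ω ^ (p - 1) * ‖Y (n + 1) ω‖ ∂P -
          (p - 1) * ∫ ω, runningMax Y n ω ^ p ∂P ≤
          p * ∫ ω, runningMax Y (n + 1) ω ^ (p - 1) * ‖Y (n + 1) ω‖ ∂P -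
          (p - 1) * ∫ ω, runningMax Y (n + 1) ω ^ p ∂P := by
        rw [← integral_const_mul, ← integral_const_mul, ← integral_const_mul, ← integral_const_mul,
          ← integral_sub ((hSY le_rfl n.le_succ).const_mul p) ((hSp n).const_mul _),
          ← integral_sub ((hSY le_rfl le_rfl).const_mul p) ((hSp (n + 1)).const_mul _)]
        refine integral_mono (((hSY le_rfl n.le_succ).const_mul p).sub ((hSp n).const_mul _))
          (((hSY le_rfl le_rfl).const_mul p).sub ((hSp (n + 1)).const_mul _)) fun ω => ?_
        rcases max_choice (runningMax Y n ω) ‖Y (n + 1) ω‖ with h | h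
        · simp only [runningMax, h]; exact le_rfl
        · simp only [runningMax, h]
          refine (Real.mul_rpow_sub_one_mul_le hp (runningMax_nonneg Y n ω)
            (norm_nonneg (Y (n + 1) ω))).trans ?_
          rw [← Real.rpow_add_one' (norm_nonneg _) (by linarith), sub_add_cancel]
          linarith
      nlinarith
  have h1 : p * ∫ ω, runningMax Y n ω ^ (p - 1) * ‖Y n ω‖ ∂P ≤
      (p - 1) / 2 * ∫ ω, runningMax Y n ω ^ p ∂P +
        (p - 1) / 2 * (doobConst p * ∫ ω, ‖Y n ω‖ ^ p ∂P) := by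
    rw [← integral_const_mul, ← integral_const_mul, ← integral_const_mul, ← integral_const_mul,
      ← integral_add ((hSp n).const_mul _) (((hint n).const_mul _).const_mul _)]
    refine integral_mono ((hSY le_rfl le_rfl).const_mul p)
      (((hSp n).const_mul _).add (((hint n).const_mul _).const_mul _)) fun ω => ?_
    exact Real.mul_rpow_sub_one_mul_le_add hp (runningMax_nonneg Y n ω) (norm_nonneg _)
  have h2 := hA n
  have h3 : (p - 1) / 2 * ∫ ω, runningMax Y n ω ^ p ∂P ≤
      (p - 1) / 2 * (doobConst p * ∫ ω, ‖Y n ω‖ ^ p ∂P) := by linarith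
  exact le_of_mul_le_mul_left h3 (by positivity)

end Doob

/-! ### Counting oscillations of a square integrable martingale. -/

section Oscillation

variable {Ω E : Type*} [NormedAddCommGroup E]

open Classical in
/-- The reference value of a sequence: it is updated to the current value as soon as the latter is
more than `ε` away from it. -/
noncomputable def oscRef (ε : ℝ) (Y : ℕ → Ω → E) : ℕ → Ω → E
  | 0, ω => Y 0 ω
  | n + 1, ω => if ε < ‖Y (n + 1) ω - oscRef ε Y n ω‖ then Y (n + 1) ω else oscRef ε Y n ω

open Classical in
/-- The number of updates of the reference value `oscRef`. -/
noncomputable def oscCount (ε : ℝ) (Y : ℕ → Ω → E) : ℕ → Ω → ℕ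
  | 0, _ => 0
  | n + 1, ω => oscCount ε Y n ω + if ε < ‖Y (n + 1) ω - oscRef ε Y n ω‖ then 1 else 0

theorem oscCount_mono (ε : ℝ) (Y : ℕ → Ω → E) (ω : Ω) : Monotone fun n => oscCount ε Y n ω :=
  monotone_nat_of_le_succ fun _ => Nat.le_add_right _ _

theorem oscCount_le (ε : ℝ) (Y : ℕ → Ω → E) (n : ℕ) (ω : Ω) : oscCount ε Y n ω ≤ n := by
  induction n with
  | zero => exact le_rfl
  | succ n ih => simp only [oscCount]; split_ifs <;> omega

theorem norm_sub_oscRef_le {ε : ℝ} (hε : 0 ≤ ε) (Y : ℕ → Ω → E) (n : ℕ) (ω : Ω) :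
    ‖Y n ω - oscRef ε Y n ω‖ ≤ ε := by
  cases n with
  | zero => simpa [oscRef] using hε
  | succ n =>
    simp only [oscRef]
    split_ifs with h
    · simpa using hε
    · exact not_lt.1 h

theorem oscRef_eq_of_oscCount_eq {ε : ℝ} {Y : ℕ → Ω → E} {ω : Ω} {i j : ℕ} (hij : i ≤ j)
    (h : oscCount ε Y j ω ≤ oscCount ε Y i ω) : oscRef ε Y j ω = oscRef ε Y i ω := by
  induction j, hij using Nat.le_induction with
  | base => rfl
  | succ j hij ih =>
    have h1 : oscCount ε Y i ω ≤ oscCount ε Y j ω := oscCount_mono ε Y ω hij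
    simp only [oscCount] at h
    simp only [oscRef]
    split_ifs at h ⊢
    · omega
    · exact ih h

/-- Without an update in between, both values lie within `ε` of the same reference; hence the factor
2. -/
theorem oscCount_lt_of_lt_norm_sub {ε : ℝ} (hε : 0 ≤ ε) {Y : ℕ → Ω → E} {ω : Ω} {i j : ℕ}
    (hij : i ≤ j) (h : 2 * ε < ‖Y j ω - Y i ω‖) : oscCount ε Y i ω < oscCount ε Y j ω := by
  by_contra! hle
  have h1 := oscRef_eq_of_oscCount_eq hij hle
  have h2 := norm_sub_oscRef_le hε Y i ω
  have h3 := norm_sub_oscRef_le hε Y j ω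
  rw [h1] at h3
  have : Y j ω - Y i ω = (Y j ω - oscRef ε Y i ω) - (Y i ω - oscRef ε Y i ω) := by abel
  rw [this] at h
  linarith [norm_sub_le (Y j ω - oscRef ε Y i ω) (Y i ω - oscRef ε Y i ω)]

variable {mΩ : MeasurableSpace Ω} {P : Measure Ω} {𝓕 : Filtration ℕ mΩ} {Y : ℕ → Ω → E}

theorem stronglyMeasurable_oscRef (hY : StronglyAdapted 𝓕 Y) (ε : ℝ) (n : ℕ) :
    StronglyMeasurable[𝓕 n] (oscRef ε Y n) := by
  induction n with
  | zero => exact hY 0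
  | succ n ih =>
    have ih' := ih.mono (𝓕.mono n.le_succ)
    exact StronglyMeasurable.ite (measurableSet_lt measurable_const
      ((hY (n + 1)).sub ih').norm.measurable) (hY (n + 1)) ih'

theorem measurable_oscCount (hY : StronglyAdapted 𝓕 Y) (ε : ℝ) (n : ℕ) :
    Measurable (oscCount ε Y n) := by
  induction n with
  | zero => exact measurable_const
  | succ n ih =>
    have h : MeasurableSet {ω | ε < ‖Y (n + 1) ω - oscRef ε Y n ω‖} :=
      measurableSet_lt measurable_const (((hY (n + 1)).mono (𝓕.le _)).sub
        ((stronglyMeasurable_oscRef hY ε n).mono (𝓕.le _))).norm.measurable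
    exact ih.add (Measurable.ite h measurable_const measurable_const)

theorem memLp_oscRef (hY : StronglyAdapted 𝓕 Y) {p : ℝ≥0∞} (hint : ∀ k, MemLp (Y k) p P) (ε : ℝ)
    (n : ℕ) : MemLp (oscRef ε Y n) p P := by
  induction n with
  | zero => exact hint 0
  | succ n ih =>
    refine ((hint (n + 1)).norm.add ih.norm).of_le
      ((stronglyMeasurable_oscRef hY ε (n + 1)).mono (𝓕.le _)).aestronglyMeasurable
      (.of_forall fun ω => ?_)
    simp only [oscRef, Pi.add_apply]
    rw [Real.norm_of_nonneg (by positivity)]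
    split_ifs
    · linarith [norm_nonneg (oscRef ε Y n ω)]
    · linarith [norm_nonneg (Y (n + 1) ω)]

theorem MeasureTheory.Martingale.integral_inner_eq {ι : Type*} [Preorder ι] [InnerProductSpace ℝ E]
    [CompleteSpace E] [IsFiniteMeasure P] {𝓕 : Filtration ι mΩ} {Y : ι → Ω → E}
    (hY : Martingale Y 𝓕 P) {i j : ι} (hij : i ≤ j) {f : Ω → E} (hf : StronglyMeasurable[𝓕 i] f)
    (hfY : Integrable (fun ω => inner ℝ (f ω) (Y j ω)) P) :
    ∫ ω, inner ℝ (f ω) (Y j ω) ∂P = ∫ ω, inner ℝ (f ω) (Y i ω) ∂P := by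
  have h := condExp_bilin_of_stronglyMeasurable_left (μ := P)
    (innerSL ℝ (E := E) : E →L[ℝ] E →L[ℝ] ℝ) hf hfY (hY.integrable j)
  rw [← integral_condExp (𝓕.le i) (f := fun ω => inner ℝ (f ω) (Y j ω))]
  refine integral_congr_ae ?_
  filter_upwards [h, hY.condExp_ae_eq hij] with ω h1 h2
  refine Eq.trans h1 ?_
  rw [h2]
  rfl

/-- A square integrable martingale has few oscillations of a given size. -/
theorem MeasureTheory.Martingale.integral_oscCount_le [InnerProductSpace ℝ E] [CompleteSpace E]
    [IsFiniteMeasure P] (hY : Martingale Y 𝓕 P) (hint : ∀ k, MemLp (Y k) 2 P) {ε : ℝ}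
    (hε : 0 ≤ ε) (n : ℕ) :
    ε ^ 2 * ∫ ω, (oscCount ε Y n ω : ℝ) ∂P ≤ ∫ ω, ‖Y n ω‖ ^ 2 ∂P := by
  have hN : ∀ n, Integrable (fun ω => (oscCount ε Y n ω : ℝ)) P := fun n =>
    (integrable_const (n : ℝ)).mono'
      (measurable_from_top.comp (measurable_oscCount hY.1 ε n)).aestronglyMeasurable
      (.of_forall fun ω => by simpa using oscCount_le ε Y n ω)
  have hR : ∀ n, MemLp (oscRef ε Y n) 2 P := memLp_oscRef hY.1 hint ε
  have hsq : ∀ {f : Ω → E}, MemLp f 2 P → Integrable (fun ω => ‖f ω‖ ^ 2) P := fun hf =>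
    hf.integrable_norm_pow two_ne_zero
  have hRY : ∀ n k, Integrable (fun ω => inner ℝ (oscRef ε Y n ω) (Y k ω)) P := fun n k =>
    ((hR n).norm.integrable_mul (hint k).norm).mono' ((hR n).1.inner (hint k).1)
      (.of_forall fun ω => norm_inner_le_norm _ _)
  -- `Q` has nonincreasing mean. With the reference `R` kept, its increment is `2⟨R, Y n⟩ - 2⟨R, Y
  -- (n + 1)⟩`, of mean zero by the martingale property; an update exchanges `‖Y (n + 1) - R‖ ^ 2 >
  -- ε ^ 2` for one count worth `ε ^ 2`.
  let Q : ℕ → Ω → ℝ := fun n ω =>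
    ε ^ 2 * oscCount ε Y n ω + ‖Y n ω - oscRef ε Y n ω‖ ^ 2 - ‖Y n ω‖ ^ 2
  have hQint : ∀ n, Integrable (Q n) P := fun n =>
    (((hN n).const_mul _).add (hsq ((hint n).sub (hR n)))).sub (hsq (hint n))
  have hstep : ∀ n ω, Q (n + 1) ω ≤ Q n ω + (2 * inner ℝ (oscRef ε Y n ω) (Y n ω) -
      2 * inner ℝ (oscRef ε Y n ω) (Y (n + 1) ω)) := by
    intro n ω
    have h1 := norm_sub_sq_real (Y n ω) (oscRef ε Y n ω)
    have h2 := norm_sub_sq_real (Y (n + 1) ω) (oscRef ε Y n ω)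
    rw [real_inner_comm] at h1 h2
    simp only [Q, oscRef, oscCount]
    split_ifs with h
    · have h3 : ε ^ 2 ≤ ‖Y (n + 1) ω - oscRef ε Y n ω‖ ^ 2 := by gcongr
      push_cast
      rw [sub_self, norm_zero]
      nlinarith
    · push_cast
      nlinarith
  have hQ : ∀ n, ∫ ω, Q n ω ∂P ≤ 0 := by
    intro n
    induction n with
    | zero =>
      refine integral_nonpos fun ω => ?_
      simp only [Q, oscRef, oscCount, sub_self, norm_zero]
      simp
    | succ n ih =>
      have h1 : Integrable (fun ω => 2 * inner ℝ (oscRef ε Y n ω) (Y n ω) -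
          2 * inner ℝ (oscRef ε Y n ω) (Y (n + 1) ω)) P :=
        ((hRY n n).const_mul 2).sub ((hRY n (n + 1)).const_mul 2)
      refine (integral_mono (hQint (n + 1)) ((hQint n).add h1) (hstep n)).trans ?_
      rw [integral_add' (hQint n) h1, integral_sub ((hRY n n).const_mul 2)
        ((hRY n (n + 1)).const_mul 2), integral_const_mul, integral_const_mul,
        hY.integral_inner_eq n.le_succ (stronglyMeasurable_oscRef hY.1 ε n) (hRY n (n + 1)),
        sub_self, add_zero]
      exact ih
  have h1 : ∫ ω, (ε ^ 2 * (oscCount ε Y n ω : ℝ) - ‖Y n ω‖ ^ 2) ∂P ≤ 0 := by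
    refine (integral_mono (((hN n).const_mul _).sub (hsq (hint n))) (hQint n) fun ω => ?_).trans
      (hQ n)
    simp only [Q, Pi.sub_apply]
    linarith [sq_nonneg ‖Y n ω - oscRef ε Y n ω‖]
  rw [integral_sub ((hN n).const_mul _) (hsq (hint n)), integral_const_mul] at h1
  linarith

end Oscillation

/-! ### From discrete time to countable sets of times. -/

section Sampling

theorem Finset.exists_monotone_enumeration {ι : Type*} [LinearOrder ι] {s : Finset ι}
    (hs : s.Nonempty) : ∃ (t : ℕ → ι) (n : ℕ), Monotone t ∧ (∀ k, t k ∈ s) ∧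
      ∀ x ∈ s, ∃ k ≤ n, t k = x := by
  have hc : 0 < s.card := hs.card_pos
  -- Capping the index makes the sequence constant after the largest element.
  refine ⟨fun k => s.orderEmbOfFin rfl ⟨min k (s.card - 1), by omega⟩, s.card - 1,
    fun i j hij => ?_, fun k => s.orderEmbOfFin_mem rfl _, fun x hx => ?_⟩
  · refine (s.orderEmbOfFin rfl).monotone ?_
    rw [Fin.mk_le_mk]
    omega
  · have : x ∈ Set.range (s.orderEmbOfFin rfl) := by rw [Finset.range_orderEmbOfFin]; exact hx
    obtain ⟨k, rfl⟩ := this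
    have hk : (k : ℕ) ≤ s.card - 1 := by omega
    refine ⟨k, hk, ?_⟩
    exact congrArg (s.orderEmbOfFin rfl) (Fin.ext (min_eq_left hk))

/-- The filtration obtained by sampling a filtration along a monotone sequence of times. -/
def MeasureTheory.Filtration.sample {ι Ω : Type*} [Preorder ι] {mΩ : MeasurableSpace Ω}
    (𝓕 : Filtration ι mΩ) {t : ℕ → ι} (ht : Monotone t) : Filtration ℕ mΩ where
  seq k := 𝓕 (t k)
  mono' _ _ h := 𝓕.mono (ht h)
  le' k := 𝓕.le (t k)

variable {Ω E : Type*} {mΩ : MeasurableSpace Ω} {P : Measure Ω}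
  [NormedAddCommGroup E] [NormedSpace ℝ E] [CompleteSpace E]

theorem integrable_norm_condExp_rpow {p : ℝ} (hp : 1 ≤ p) {V : Ω → E}
    (hV : Integrable (fun ω => ‖V ω‖ ^ p) P) {m : MeasurableSpace Ω} (hm : m ≤ mΩ) :
    Integrable (fun ω => ‖P[V | m] ω‖ ^ p) P := by
  refine (integrable_condExp (m := m) (f := fun ω => ‖V ω‖ ^ p)).mono'
    ((Real.continuous_rpow_const (by linarith)).comp_stronglyMeasurable
    (stronglyMeasurable_condExp.mono hm).norm).aestronglyMeasurable
    ((Integrable.norm_condExp_rpow_le (m := m) hp hV).mono fun ω h => ?_)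
  rw [Real.norm_of_nonneg (by positivity)]
  exact h

theorem integral_norm_condExp_rpow_le [IsFiniteMeasure P] {p : ℝ} (hp : 1 ≤ p) {V : Ω → E}
    (hV : Integrable (fun ω => ‖V ω‖ ^ p) P) {m : MeasurableSpace Ω} (hm : m ≤ mΩ) :
    ∫ ω, ‖P[V | m] ω‖ ^ p ∂P ≤ ∫ ω, ‖V ω‖ ^ p ∂P := by
  rw [← integral_condExp hm (f := fun ω => ‖V ω‖ ^ p)]
  exact integral_mono_ae (integrable_norm_condExp_rpow hp hV hm) integrable_condExp
    (Integrable.norm_condExp_rpow_le (m := m) hp hV)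

variable [IsFiniteMeasure P] {ι : Type*} [LinearOrder ι] (𝓕 : Filtration ι mΩ)

theorem lintegral_finset_sup_condExp_rpow_le {p : ℝ} (hp : 1 < p) {V : Ω → E}
    (hV : Integrable (fun ω => ‖V ω‖ ^ p) P) {s : Finset ι} (hs : s.Nonempty) :
    ∫⁻ ω, (⨆ x ∈ s, ‖P[V | 𝓕 x] ω‖ₑ) ^ p ∂P ≤
      ENNReal.ofReal (doobConst p * ∫ ω, ‖V ω‖ ^ p ∂P) := by
  obtain ⟨t, n, ht, -, hts⟩ := Finset.exists_monotone_enumeration hs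
  have hY : Martingale (fun k => P[V | 𝓕 (t k)]) (𝓕.sample ht) P := martingale_condExp _ _ _
  have hint : ∀ k, Integrable (fun ω => ‖P[V | 𝓕 (t k)] ω‖ ^ p) P := fun k =>
    integrable_norm_condExp_rpow hp.le hV (𝓕.le _)
  have h1 := hY.integral_runningMax_rpow_le hp hint n
  have h2 : ∫⁻ ω, (⨆ x ∈ s, ‖P[V | 𝓕 x] ω‖ₑ) ^ p ∂P ≤
      ∫⁻ ω, ENNReal.ofReal (runningMax (fun k => P[V | 𝓕 (t k)]) n ω ^ p) ∂P := by
    refine lintegral_mono fun ω => ?_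
    rw [← ENNReal.ofReal_rpow_of_nonneg (runningMax_nonneg _ _ _) (by linarith)]
    refine ENNReal.rpow_le_rpow (iSup₂_le fun x hx => ?_) (by linarith)
    obtain ⟨k, hk, rfl⟩ := hts x hx
    rw [← ofReal_norm]
    exact ENNReal.ofReal_le_ofReal (norm_le_runningMax (fun k => P[V | 𝓕 (t k)]) ω hk)
  refine h2.trans ?_
  rw [← ofReal_integral_eq_lintegral_ofReal (integrable_runningMax_rpow hY.1 (by linarith) hint n)
    (.of_forall fun ω => Real.rpow_nonneg (runningMax_nonneg _ _ _) _)]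
  refine ENNReal.ofReal_le_ofReal (h1.trans ?_)
  exact mul_le_mul_of_nonneg_left (integral_norm_condExp_rpow_le hp.le hV (𝓕.le _))
    (doobConst_nonneg hp)

/-- **Doob's `L^p` inequality** along a countable set of times. -/
theorem lintegral_biSup_condExp_rpow_le {p : ℝ} (hp : 1 < p) {V : Ω → E}
    (hV : Integrable (fun ω => ‖V ω‖ ^ p) P) {D : Set ι} (hD : D.Countable) (hne : D.Nonempty) :
    ∫⁻ ω, (⨆ x ∈ D, ‖P[V | 𝓕 x] ω‖ₑ) ^ p ∂P ≤
      ENNReal.ofReal (doobConst p * ∫ ω, ‖V ω‖ ^ p ∂P) := by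
  classical
  obtain ⟨d, rfl⟩ := hD.exists_eq_range hne
  have hp0 : 0 < p := by linarith
  -- The bound for finite sets does not depend on the set, so monotone convergence along this
  -- exhaustion suffices.
  let s : ℕ → Finset ι := fun n => (Finset.range (n + 1)).image d
  have hs : ∀ n, (s n).Nonempty := fun n => by simp [s]
  have hsmono : Monotone s := fun i j hij => Finset.image_mono _ (Finset.range_mono (by omega))
  have h1 : ∀ ω, (⨆ x ∈ Set.range d, ‖P[V | 𝓕 x] ω‖ₑ) ^ p =
      ⨆ n, (⨆ x ∈ s n, ‖P[V | 𝓕 x] ω‖ₑ) ^ p := fun ω => by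
    have h := (ENNReal.orderIsoRpow p hp0).map_iSup fun n => ⨆ x ∈ s n, ‖P[V | 𝓕 x] ω‖ₑ
    simp only [ENNReal.orderIsoRpow_apply] at h
    rw [← h]
    congr 1
    refine le_antisymm (iSup₂_le ?_) (iSup_le fun n => iSup₂_le fun x hx => ?_)
    · rintro _ ⟨n, rfl⟩
      exact le_iSup_of_le n (le_iSup₂_of_le (d n)
        (Finset.mem_image_of_mem d (Finset.self_mem_range_succ n)) le_rfl)
    · obtain ⟨k, -, rfl⟩ := Finset.mem_image.1 hx
      exact le_iSup₂_of_le (d k) ⟨k, rfl⟩ le_rfl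
  simp_rw [h1]
  rw [lintegral_iSup (fun n => ?_) fun i j hij ω => ?_]
  · exact iSup_le fun n => lintegral_finset_sup_condExp_rpow_le 𝓕 hp hV (hs n)
  · refine Measurable.pow_const (Measurable.biSup _ (s n).countable_toSet fun x _ => ?_) p
    exact (stronglyMeasurable_condExp.mono (𝓕.le x)).enorm
  · exact ENNReal.rpow_le_rpow (biSup_mono fun x hx => hsmono hij hx) hp0.le

end Sampling

/-! ### Chains of large increments. -/

section Regulated

variable {ι E : Type*} [LinearOrder ι] [NormedAddCommGroup E]

/-- `f` has `m` successive increments larger than `ε` along times in `D`. -/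
def HasChain (D : Set ι) (f : ι → E) (ε : ℝ) (m : ℕ) : Prop :=
  ∃ u : ℕ → ι, Monotone u ∧ (∀ j, u j ∈ D) ∧ ∀ j < m, ε < ‖f (u (j + 1)) - f (u j)‖

/-- `f` has only finitely many successive increments of any given size along `D`. -/
def IsRegulatedOn (D : Set ι) (f : ι → E) : Prop :=
  ∀ ε > 0, ∃ m, ¬ HasChain D f ε m

theorem HasChain.mono {D D' : Set ι} {f g : ι → E} {ε ε' : ℝ} {m : ℕ} (h : HasChain D f ε m)
    (hD : D ⊆ D') (hfg : ∀ x ∈ D, 2 * ‖f x - g x‖ + ε' ≤ ε) : HasChain D' g ε' m := by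
  obtain ⟨u, hu, huD, h⟩ := h
  refine ⟨u, hu, fun j => hD (huD j), fun j hj => ?_⟩
  have h1 := hfg _ (huD j)
  have h2 := hfg _ (huD (j + 1))
  have h3 : f (u (j + 1)) - f (u j) = (f (u (j + 1)) - g (u (j + 1))) - (f (u j) - g (u j)) +
    (g (u (j + 1)) - g (u j)) := by abel
  have h4 := h j hj
  rw [h3] at h4
  linarith [norm_add_le ((f (u (j + 1)) - g (u (j + 1))) - (f (u j) - g (u j)))
    (g (u (j + 1)) - g (u j)), norm_sub_le (f (u (j + 1)) - g (u (j + 1))) (f (u j) - g (u j))]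

theorem HasChain.exists_index {d : ℕ → ι} {f : ι → E} {ε : ℝ} {m : ℕ}
    (h : HasChain (Set.range d) f ε m) : ∃ n, HasChain (d '' Set.Iic n) f ε m := by
  obtain ⟨u, hu, huD, h⟩ := h
  choose i hi using huD
  refine ⟨(Finset.range (m + 1)).sup i, fun j => u (min j m),
    fun a b hab => hu (min_le_min_right _ hab), fun j => ⟨i (min j m), ?_, hi _⟩, fun j hj => ?_⟩
  · exact Finset.le_sup (f := i) (Finset.mem_range.2 (by omega))
  · simpa only [min_eq_left hj.le, min_eq_left (Nat.succ_le_of_lt hj)] using h j hj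

/-- Each increment larger than `2 * ε` forces an update of the reference between the corresponding
indices. -/
theorem HasChain.le_oscCount {Ω : Type*} {Y : ι → Ω → E} {ω : Ω} {ε : ℝ} (hε : 0 ≤ ε)
    {s : Set ι} {t : ℕ → ι} {n m : ℕ} (ht : Monotone t) (hts : ∀ x ∈ s, ∃ k ≤ n, t k = x)
    (h : HasChain s (fun x => Y x ω) (2 * ε) m) : m ≤ oscCount ε (fun k => Y (t k)) n ω := by
  obtain ⟨u, hu, hus, h⟩ := h
  choose i hin hi using fun j => hts _ (hus j)
  have key : ∀ j ≤ m, j ≤ oscCount ε (fun k => Y (t k)) (i j) ω := by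
    intro j
    induction j with
    | zero => intro; omega
    | succ j ih =>
      intro hj
      have h1 := h j (by omega)
      have hle : i j ≤ i (j + 1) := by
        -- If the indices were in the wrong order, the two times would coincide and the increment
        -- would vanish.
        by_contra! hlt
        have h2 := ht hlt.le
        rw [hi, hi] at h2
        have h3 : u j = u (j + 1) := le_antisymm (hu j.le_succ) h2
        rw [h3, sub_self, norm_zero] at h1
        linarith
      have h4 := oscCount_lt_of_lt_norm_sub (Y := fun k => Y (t k)) (ω := ω) hε hle
        (by simpa only [hi] using h1)
      have h5 := ih (by omega)
      omega
  exact (key m le_rfl).trans (oscCount_mono ε _ ω (hin m))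

end Regulated

/-! ### Almost sure regularity of martingale paths. -/

section AlmostSurelyRegulated

variable {Ω E : Type*} {mΩ : MeasurableSpace Ω} {P : Measure Ω} [IsProbabilityMeasure P]
  [NormedAddCommGroup E] [InnerProductSpace ℝ E] [CompleteSpace E] {ι : Type*} [LinearOrder ι]
  (𝓕 : Filtration ι mΩ)

/-- Markov's inequality for the oscillation count; the bound is independent of `s` and tends to zero
as `m` grows. -/
theorem measure_hasChain_condExp_finset_le {V : Ω → E} (hV : Integrable (fun ω => ‖V ω‖ ^ 2) P)
    {ε : ℝ} (hε : 0 < ε) {m : ℕ} (hm : 0 < m) {s : Finset ι} (hs : s.Nonempty) :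
    P {ω | HasChain (s : Set ι) (fun x => P[V | 𝓕 x] ω) (2 * ε) m} ≤
      ENNReal.ofReal ((∫ ω, ‖V ω‖ ^ 2 ∂P) / ε ^ 2 / m) := by
  obtain ⟨t, n, ht, -, hts⟩ := Finset.exists_monotone_enumeration hs
  have hm' : (0 : ℝ) < m := by exact_mod_cast hm
  have hV' : Integrable (fun ω => ‖V ω‖ ^ (2 : ℝ)) P := by simpa using hV
  have hY : Martingale (fun k => P[V | 𝓕 (t k)]) (𝓕.sample ht) P := martingale_condExp _ _ _
  have hint : ∀ k, MemLp (P[V | 𝓕 (t k)]) 2 P := fun k => by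
    rw [← integrable_norm_rpow_iff (stronglyMeasurable_condExp.mono (𝓕.le _)).aestronglyMeasurable
      two_ne_zero ENNReal.ofNat_ne_top]
    simpa using integrable_norm_condExp_rpow one_le_two hV' (𝓕.le _)
  have h1 := hY.integral_oscCount_le hint hε.le n
  have h2 : ∫ ω, ‖P[V | 𝓕 (t n)] ω‖ ^ 2 ∂P ≤ ∫ ω, ‖V ω‖ ^ 2 ∂P := by
    simpa using integral_norm_condExp_rpow_le one_le_two hV' (𝓕.le (t n))
  have hNint : Integrable (fun ω => (oscCount ε (fun k => P[V | 𝓕 (t k)]) n ω : ℝ)) P :=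
    (integrable_const (n : ℝ)).mono'
      (measurable_from_top.comp (measurable_oscCount hY.1 ε n)).aestronglyMeasurable
      (.of_forall fun ω => by simpa using oscCount_le ε _ n ω)
  have h3 := mul_meas_ge_le_integral_of_nonneg (μ := P)
    (f := fun ω => (oscCount ε (fun k => P[V | 𝓕 (t k)]) n ω : ℝ))
    (.of_forall fun ω => Nat.cast_nonneg _) hNint (m : ℝ)
  have h4 : P.real {ω | (m : ℝ) ≤ (oscCount ε (fun k => P[V | 𝓕 (t k)]) n ω : ℝ)} ≤
      (∫ ω, ‖V ω‖ ^ 2 ∂P) / ε ^ 2 / m := by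
    rw [le_div_iff₀ hm', le_div_iff₀ (by positivity)]
    nlinarith [sq_nonneg ε]
  refine (measure_mono fun ω hω => ?_).trans
    ((ENNReal.le_ofReal_iff_toReal_le (measure_ne_top _ _)
      (measureReal_nonneg.trans h4)).2 h4)
  have := HasChain.le_oscCount (Y := fun x => P[V | 𝓕 x]) (n := n) hε.le ht hts hω
  exact (Nat.cast_le (α := ℝ)).2 this

theorem measure_forall_hasChain_condExp_eq_zero {V : Ω → E}
    (hV : Integrable (fun ω => ‖V ω‖ ^ 2) P) {ε : ℝ} (hε : 0 < ε) {D : Set ι} (hD : D.Countable)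
    (hne : D.Nonempty) :
    P {ω | ∀ m, HasChain D (fun x => P[V | 𝓕 x] ω) (2 * ε) m} = 0 := by
  classical
  obtain ⟨d, rfl⟩ := hD.exists_eq_range hne
  have hbound : ∀ m : ℕ, 0 < m →
      P {ω | HasChain (Set.range d) (fun x => P[V | 𝓕 x] ω) (2 * ε) m} ≤
        ENNReal.ofReal ((∫ ω, ‖V ω‖ ^ 2 ∂P) / ε ^ 2 / m) := by
    intro m hm
    refine (measure_mono (t := ⋃ n,
      {ω | HasChain (d '' Set.Iic n) (fun x => P[V | 𝓕 x] ω) (2 * ε) m}) fun ω hω => ?_).trans ?_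
    · rw [Set.mem_ofPred_eq] at hω
      exact Set.mem_iUnion.2 (HasChain.exists_index hω)
    · rw [Monotone.measure_iUnion]
      · refine iSup_le fun n => ?_
        have := measure_hasChain_condExp_finset_le 𝓕 hV hε hm
          (s := (Finset.Iic n).image d) (by simp)
        simpa using this
      · intro i j hij ω hω
        simp only [Set.mem_ofPred_eq] at hω ⊢
        exact HasChain.mono hω (Set.image_mono (Set.Iic_subset_Iic.2 hij)) fun x _ => by simp
  have hlim : Tendsto (fun m : ℕ => ENNReal.ofReal ((∫ ω, ‖V ω‖ ^ 2 ∂P) / ε ^ 2 / m)) atTop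
      (𝓝 0) := by
    have := ENNReal.tendsto_ofReal (tendsto_const_div_atTop_nhds_zero_nat
      ((∫ ω, ‖V ω‖ ^ 2 ∂P) / ε ^ 2))
    simpa using this
  refine le_antisymm (ge_of_tendsto hlim ?_) zero_le
  filter_upwards [eventually_gt_atTop 0] with m hm
  refine (measure_mono fun ω hω => ?_).trans (hbound m hm)
  rw [Set.mem_ofPred_eq] at hω ⊢
  exact hω m

/-- Almost surely, the restriction of an `L^p`-martingale, `1 < p`, to a countable set of times is
regulated. -/
theorem ae_isRegulatedOn_condExp {p : ℝ} (hp : 1 < p) {V : Ω → E}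
    (hV : MemLp V (ENNReal.ofReal p) P) {D : Set ι} (hD : D.Countable) (hne : D.Nonempty) :
    ∀ᵐ ω ∂P, IsRegulatedOn D fun x => P[V | 𝓕 x] ω := by
  have hp0 : 0 < p := by linarith
  have hp1 : 1 ≤ ENNReal.ofReal p := by simpa using hp.le
  have hp0' : ENNReal.ofReal p ≠ 0 := by simpa using hp0
  have hmain : ∀ ε : ℝ, 0 < ε → P {ω | ∀ m, HasChain D (fun x => P[V | 𝓕 x] ω) (4 * ε) m} = 0 := by
    intro ε hε
    have hεp : (0 : ℝ≥0∞) < ENNReal.ofReal ε ^ p :=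
      ENNReal.rpow_pos (by simpa using hε) ENNReal.ofReal_ne_top
    -- The square integrable martingale of `g` almost surely lacks arbitrarily long chains of size
    -- `2 * ε`. So chains of size `4 * ε` of every length require the martingale of `V - g` to reach
    -- norm `ε` on `D`, which Chebyshev and Doob bound by the `L^p` distance of `g` from `V`.
    have hbound : ∀ g : SimpleFunc Ω E, MemLp g (ENNReal.ofReal p) P →
        P {ω | ∀ m, HasChain D (fun x => P[V | 𝓕 x] ω) (4 * ε) m} ≤
        ENNReal.ofReal (doobConst p) * eLpNorm (V - ⇑g) (ENNReal.ofReal p) P ^ p /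
          ENNReal.ofReal ε ^ p := by
      intro g hg
      have hVg := hV.sub hg
      have hVg' : Integrable (fun ω => ‖(V - ⇑g) ω‖ ^ p) P := by
        simpa [ENNReal.toReal_ofReal hp0.le] using
          hVg.integrable_norm_rpow hp0' ENNReal.ofReal_ne_top
      have hsub : ∀ᵐ ω ∂P, ∀ x ∈ D, P[V - ⇑g | 𝓕 x] ω = P[V | 𝓕 x] ω - P[g | 𝓕 x] ω := by
        rw [ae_ball_iff hD]
        intro x _
        exact condExp_sub (hV.integrable hp1) (hg.integrable hp1) _
      have hg2 : Integrable (fun ω => ‖g ω‖ ^ 2) P :=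
        (SimpleFunc.memLp_of_isFiniteMeasure g 2 P).integrable_norm_pow two_ne_zero
      have h1 := measure_forall_hasChain_condExp_eq_zero 𝓕 hg2 hε hD hne
      have h2 : P {ω | ENNReal.ofReal ε ^ p ≤ (⨆ x ∈ D, ‖P[V - ⇑g | 𝓕 x] ω‖ₑ) ^ p} ≤
          (∫⁻ ω, (⨆ x ∈ D, ‖P[V - ⇑g | 𝓕 x] ω‖ₑ) ^ p ∂P) / ENNReal.ofReal ε ^ p := by
        refine meas_ge_le_lintegral_div (Measurable.aemeasurable (Measurable.pow_const
          (Measurable.biSup _ hD fun x _ => ?_) p)) hεp.ne' (by simp [hp0.le])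
        exact (stronglyMeasurable_condExp.mono (𝓕.le x)).enorm
      have h3 := lintegral_biSup_condExp_rpow_le 𝓕 hp hVg' hD hne
      have h4 : ENNReal.ofReal (doobConst p * ∫ ω, ‖(V - ⇑g) ω‖ ^ p ∂P) =
          ENNReal.ofReal (doobConst p) * eLpNorm (V - ⇑g) (ENNReal.ofReal p) P ^ p := by
        rw [ENNReal.ofReal_mul (doobConst_nonneg hp),
          hVg.eLpNorm_eq_integral_rpow_norm hp0' ENNReal.ofReal_ne_top,
          ENNReal.toReal_ofReal hp0.le, ENNReal.ofReal_rpow_of_nonneg (by positivity) hp0.le,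
          ← Real.rpow_mul (by positivity), inv_mul_cancel₀ hp0.ne', Real.rpow_one]
      rw [h4] at h3
      refine le_trans ?_ (h2.trans (ENNReal.div_le_div_right h3 _))
      refine measure_mono_ae ?_
      filter_upwards [hsub, measure_eq_zero_iff_ae_notMem.1 h1] with ω hω1 hω2 hω
      by_contra hlt
      have hlt : (⨆ x ∈ D, ‖P[V - ⇑g | 𝓕 x] ω‖ₑ) ^ p < ENNReal.ofReal ε ^ p := not_le.1 hlt
      rw [ENNReal.rpow_lt_rpow_iff hp0] at hlt
      have hω' : ∀ m, HasChain D (fun x => P[V | 𝓕 x] ω) (4 * ε) m := hω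
      refine hω2 fun m => (hω' m).mono subset_rfl fun x hx => ?_
      have h5 : ‖P[V - ⇑g | 𝓕 x] ω‖ₑ ≤ ENNReal.ofReal ε :=
        (le_iSup₂ (f := fun x (_ : x ∈ D) => ‖P[V - ⇑g | 𝓕 x] ω‖ₑ) x hx).trans hlt.le
      rw [← ofReal_norm, ENNReal.ofReal_le_ofReal_iff hε.le, hω1 x hx] at h5
      linarith
    obtain ⟨g, hg, hgp⟩ : ∃ g : ℕ → SimpleFunc Ω E,
        (∀ n, eLpNorm (V - ⇑(g n)) (ENNReal.ofReal p) P < (n + 1 : ℝ≥0∞)⁻¹) ∧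
        ∀ n, MemLp (g n) (ENNReal.ofReal p) P := by
      have := fun n : ℕ => hV.exists_simpleFunc_eLpNorm_sub_lt ENNReal.ofReal_ne_top
        (ε := (n + 1 : ℝ≥0∞)⁻¹) (by simp)
      choose g hg using this
      exact ⟨g, fun n => (hg n).1, fun n => (hg n).2⟩
    have hlim0 : Tendsto (fun n => eLpNorm (V - ⇑(g n)) (ENNReal.ofReal p) P) atTop (𝓝 0) := by
      have h0 : Tendsto (fun n : ℕ => (n + 1 : ℝ≥0∞)⁻¹) atTop (𝓝 0) := by
        have := (tendsto_add_atTop_iff_nat 1).2 ENNReal.tendsto_inv_nat_nhds_zero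
        simpa using this
      exact tendsto_of_tendsto_of_tendsto_of_le_of_le tendsto_const_nhds h0 (fun _ => zero_le)
        fun n => (hg n).le
    have hlim : Tendsto (fun n => ENNReal.ofReal (doobConst p) *
        eLpNorm (V - ⇑(g n)) (ENNReal.ofReal p) P ^ p / ENNReal.ofReal ε ^ p) atTop (𝓝 0) := by
      have h1 := ((ENNReal.continuous_rpow_const (y := p)).tendsto 0).comp hlim0
      rw [ENNReal.zero_rpow_of_pos hp0] at h1
      have h2 := ENNReal.Tendsto.div_const (ENNReal.Tendsto.const_mul (a := ENNReal.ofReal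
        (doobConst p)) h1 (.inr ENNReal.ofReal_ne_top)) (b := ENNReal.ofReal ε ^ p) (.inr hεp.ne')
      simpa using h2
    exact le_antisymm (ge_of_tendsto hlim (.of_forall fun n => hbound (g n) (hgp n))) zero_le
  have hall : ∀ᵐ ω ∂P, ∀ k : ℕ, ¬ ∀ m, HasChain D (fun x => P[V | 𝓕 x] ω) (4 * (1 / (k + 1))) m :=
    ae_all_iff.2 fun k => measure_eq_zero_iff_ae_notMem.1 (hmain _ (by positivity))
  filter_upwards [hall] with ω hω ε hε
  obtain ⟨k, hk⟩ := exists_nat_one_div_lt (show 0 < ε / 4 by positivity)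
  obtain ⟨m, hm⟩ := not_forall.1 (hω k)
  exact ⟨m, fun h => hm (h.mono subset_rfl fun x _ => by simp only [sub_self, norm_zero]; linarith)⟩

end AlmostSurelyRegulated

/-! ### One-sided limits of regulated functions. -/

section RightLimits

variable {ι E : Type*} [LinearOrder ι] [NormedAddCommGroup E]

theorem IsRegulatedOn.exists_le_of_antitone {D : Set ι} {f : ι → E} (hf : IsRegulatedOn D f)
    {u : ℕ → ι} (hu : Antitone u) (huD : ∀ j, u j ∈ D) {ε : ℝ} (hε : 0 < ε) :
    ∃ j, ‖f (u (j + 1)) - f (u j)‖ ≤ ε := by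
  obtain ⟨m, hm⟩ := hf ε hε
  by_contra! h
  -- Chains run forward in time, so the first `m` steps are reversed; truncated subtraction keeps
  -- the sequence constant afterwards.
  refine hm ⟨fun j => u (m - j), fun i j hij => hu (by omega), fun j => huD _, fun j hj => ?_⟩
  have h1 := h (m - (j + 1))
  rwa [show m - (j + 1) + 1 = m - j by omega, norm_sub_rev] at h1

theorem IsRegulatedOn.exists_le_of_monotone {D : Set ι} {f : ι → E} (hf : IsRegulatedOn D f)
    {u : ℕ → ι} (hu : Monotone u) (huD : ∀ j, u j ∈ D) {ε : ℝ} (hε : 0 < ε) :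
    ∃ j, ‖f (u (j + 1)) - f (u j)‖ ≤ ε := by
  obtain ⟨m, hm⟩ := hf ε hε
  by_contra! h
  exact hm ⟨u, hu, huD, fun j _ => h j⟩

open Classical in
/-- The right limits of `f` along `D`; at a maximal element, the value of `f`. -/
noncomputable def rightLimOn [TopologicalSpace ι] (D : Set ι) (f : ι → E) (t : ι) : E :=
  -- At a maximal element the filter is trivial and every `l` is a limit; the clause on `v` excludes
  -- this case.
  if h : ∃ l, (∃ v, t < v) ∧ Tendsto f (𝓝[D ∩ Set.Ioi t] t) (𝓝 l) then h.choose else f t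

theorem rightLimOn_of_isMax [TopologicalSpace ι] (D : Set ι) (f : ι → E) {t : ι} (ht : IsMax t) :
    rightLimOn D f t = f t :=
  dif_neg fun ⟨_, ⟨_, hv⟩, _⟩ => ht.not_lt hv

variable [TopologicalSpace ι] [OrderTopology ι]

theorem nhdsWithin_inter_Ioi_basis {D : Set ι} {t v₀ : ι} (h : t < v₀) :
    (𝓝[D ∩ Set.Ioi t] t).HasBasis (fun v => t < v) fun v => D ∩ Set.Ioo t v := by
  have h1 := (nhdsGT_basis_of_exists_gt ⟨v₀, h⟩).inf_principal D
  rw [← nhdsWithin_inter'] at h1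
  simpa only [Set.inter_comm] using h1

theorem nhdsWithin_inter_Iio_basis {D : Set ι} {t v₀ : ι} (h : v₀ < t) :
    (𝓝[D ∩ Set.Iio t] t).HasBasis (fun v => v < t) fun v => D ∩ Set.Ioo v t := by
  have h1 := (nhdsLT_basis_of_exists_lt ⟨v₀, h⟩).inf_principal D
  rw [← nhdsWithin_inter'] at h1
  simpa only [Set.inter_comm] using h1

variable [DenselyOrdered ι]

theorem Dense.nhdsWithin_inter_Ioi_neBot {D : Set ι} (hD : Dense D) {t v₀ : ι} (h : t < v₀) :
    (𝓝[D ∩ Set.Ioi t] t).NeBot := by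
  rw [(nhdsWithin_inter_Ioi_basis h).neBot_iff]
  intro v hv
  obtain ⟨s, hs, hs'⟩ := hD.exists_between hv
  exact ⟨s, hs, hs'⟩

theorem Dense.nhdsWithin_inter_Iio_neBot {D : Set ι} (hD : Dense D) {t v₀ : ι} (h : v₀ < t) :
    (𝓝[D ∩ Set.Iio t] t).NeBot := by
  rw [(nhdsWithin_inter_Iio_basis h).neBot_iff]
  intro v hv
  obtain ⟨s, hs, hs'⟩ := hD.exists_between hv
  exact ⟨s, hs, hs'⟩

variable [CompleteSpace E]

/-- If the Cauchy criterion failed, every point of `D` above `t` would have another one between `t`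
and it with value more than `ε / 3` away; iteration gives an infinite decreasing sequence of large
increments. -/
theorem IsRegulatedOn.exists_tendsto_right {D : Set ι} (hD : Dense D) {f : ι → E}
    (hf : IsRegulatedOn D f) {t v₀ : ι} (h : t < v₀) :
    ∃ l, Tendsto f (𝓝[D ∩ Set.Ioi t] t) (𝓝 l) := by
  have hbasis := nhdsWithin_inter_Ioi_basis (D := D) h
  have hne := hD.nhdsWithin_inter_Ioi_neBot h
  refine cauchy_map_iff_exists_tendsto.1 (Metric.cauchy_iff.2 ⟨hne.map f, fun ε hε => ?_⟩)
  suffices ∃ v ∈ D ∩ Set.Ioi t, ∀ s ∈ D ∩ Set.Ioo t v, ‖f s - f v‖ ≤ ε / 3 by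
    obtain ⟨v, hv, hv'⟩ := this
    refine ⟨f '' (D ∩ Set.Ioo t v), image_mem_map (hbasis.mem_of_mem hv.2), ?_⟩
    rintro _ ⟨x, hx, rfl⟩ _ ⟨y, hy, rfl⟩
    have h1 := hv' x hx
    have h2 := hv' y hy
    rw [dist_eq_norm, ← sub_sub_sub_cancel_right (f x) (f y) (f v)]
    linarith [norm_sub_le (f x - f v) (f y - f v)]
  by_contra! hcon
  choose! w hw hw' using hcon
  obtain ⟨s₀, hs₀, hs₀'⟩ := hD.exists_between h
  let u : ℕ → ι := fun n => w^[n] s₀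
  have huS : ∀ n, u n ∈ D ∩ Set.Ioi t := fun n => by
    induction n with
    | zero => exact ⟨hs₀, hs₀'.1⟩
    | succ n ih =>
      simp only [u, Function.iterate_succ_apply']
      exact ⟨(hw _ ih).1, (hw _ ih).2.1⟩
  have hu : Antitone u := antitone_nat_of_succ_le fun n => by
    simp only [u, Function.iterate_succ_apply']
    exact (hw _ (huS n)).2.2.le
  obtain ⟨j, hj⟩ := hf.exists_le_of_antitone hu (fun j => (huS j).1) (show 0 < ε / 3 by positivity)
  have := hw' _ (huS j)
  simp only [u, Function.iterate_succ_apply'] at hj this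
  linarith

theorem IsRegulatedOn.exists_tendsto_left {D : Set ι} (hD : Dense D) {f : ι → E}
    (hf : IsRegulatedOn D f) {t v₀ : ι} (h : v₀ < t) :
    ∃ l, Tendsto f (𝓝[D ∩ Set.Iio t] t) (𝓝 l) := by
  have hbasis := nhdsWithin_inter_Iio_basis (D := D) h
  have hne := hD.nhdsWithin_inter_Iio_neBot h
  refine cauchy_map_iff_exists_tendsto.1 (Metric.cauchy_iff.2 ⟨hne.map f, fun ε hε => ?_⟩)
  suffices ∃ v ∈ D ∩ Set.Iio t, ∀ s ∈ D ∩ Set.Ioo v t, ‖f s - f v‖ ≤ ε / 3 by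
    obtain ⟨v, hv, hv'⟩ := this
    refine ⟨f '' (D ∩ Set.Ioo v t), image_mem_map (hbasis.mem_of_mem hv.2), ?_⟩
    rintro _ ⟨x, hx, rfl⟩ _ ⟨y, hy, rfl⟩
    have h1 := hv' x hx
    have h2 := hv' y hy
    rw [dist_eq_norm, ← sub_sub_sub_cancel_right (f x) (f y) (f v)]
    linarith [norm_sub_le (f x - f v) (f y - f v)]
  by_contra! hcon
  choose! w hw hw' using hcon
  obtain ⟨s₀, hs₀, hs₀'⟩ := hD.exists_between h
  let u : ℕ → ι := fun n => w^[n] s₀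
  have huS : ∀ n, u n ∈ D ∩ Set.Iio t := fun n => by
    induction n with
    | zero => exact ⟨hs₀, hs₀'.2⟩
    | succ n ih =>
      simp only [u, Function.iterate_succ_apply']
      exact ⟨(hw _ ih).1, (hw _ ih).2.2⟩
  have hu : Monotone u := monotone_nat_of_le_succ fun n => by
    simp only [u, Function.iterate_succ_apply']
    exact (hw _ (huS n)).2.1.le
  obtain ⟨j, hj⟩ := hf.exists_le_of_monotone hu (fun j => (huS j).1) (show 0 < ε / 3 by positivity)
  have := hw' _ (huS j)
  simp only [u, Function.iterate_succ_apply'] at hj this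
  linarith

theorem IsRegulatedOn.tendsto_rightLimOn {D : Set ι} {f : ι → E}
    (hf : IsRegulatedOn D f) (hD : Dense D) {t v₀ : ι} (h : t < v₀) :
    Tendsto f (𝓝[D ∩ Set.Ioi t] t) (𝓝 (rightLimOn D f t)) := by
  have h1 : ∃ l, (∃ v, t < v) ∧ Tendsto f (𝓝[D ∩ Set.Ioi t] t) (𝓝 l) :=
    (hf.exists_tendsto_right hD h).imp fun l hl => ⟨⟨v₀, h⟩, hl⟩
  rw [rightLimOn, dif_pos h1]
  exact h1.choose_spec.2

/-- Closed conditions pass from `f` on `D` to its right limits; closed balls give right-continuity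
and left limits, a closed norm bound gives the control of the supremum. -/
theorem IsRegulatedOn.rightLimOn_mem {D : Set ι} {f : ι → E}
    (hf : IsRegulatedOn D f) (hD : Dense D) {A : Set E} (hA : IsClosed A) {t v : ι} (h : t < v)
    (hfA : ∀ s ∈ D ∩ Set.Ioo t v, f s ∈ A) : rightLimOn D f t ∈ A := by
  have := hD.nhdsWithin_inter_Ioi_neBot h
  exact hA.mem_of_tendsto (hf.tendsto_rightLimOn hD h)
    (mem_of_superset ((nhdsWithin_inter_Ioi_basis h).mem_of_mem h) hfA)

theorem IsRegulatedOn.rightLimOn_rightContinuous {D : Set ι} {f : ι → E}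
    (hf : IsRegulatedOn D f) (hD : Dense D) (t : ι) :
    Tendsto (rightLimOn D f) (𝓝[>] t) (𝓝 (rightLimOn D f t)) := by
  by_cases ht : IsMax t
  · rw [ht.Ioi_eq, nhdsWithin_empty]
    exact tendsto_bot
  obtain ⟨v₀, hv₀⟩ := not_isMax_iff.1 ht
  refine (nhdsGT_basis_of_exists_gt ⟨v₀, hv₀⟩).tendsto_iff Metric.nhds_basis_closedBall |>.2
    fun ε hε => ?_
  obtain ⟨v, hv, hv'⟩ := ((nhdsWithin_inter_Ioi_basis hv₀).tendsto_iff
    Metric.nhds_basis_closedBall).1 (hf.tendsto_rightLimOn hD hv₀) ε hε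
  exact ⟨v, hv, fun s hs => hf.rightLimOn_mem hD Metric.isClosed_closedBall hs.2
    fun x hx => hv' x ⟨hx.1, hs.1.trans hx.2.1, hx.2.2⟩⟩

theorem IsRegulatedOn.rightLimOn_leftLimit {D : Set ι} {f : ι → E}
    (hf : IsRegulatedOn D f) (hD : Dense D) (t : ι) :
    ∃ l, Tendsto (rightLimOn D f) (𝓝[<] t) (𝓝 l) := by
  by_cases ht : IsMin t
  · rw [ht.Iio_eq, nhdsWithin_empty]
    exact ⟨0, tendsto_bot⟩
  obtain ⟨v₀, hv₀⟩ := not_isMin_iff.1 ht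
  obtain ⟨l, hl⟩ := hf.exists_tendsto_left hD hv₀
  refine ⟨l, (nhdsLT_basis_of_exists_lt ⟨v₀, hv₀⟩).tendsto_iff Metric.nhds_basis_closedBall |>.2
    fun ε hε => ?_⟩
  obtain ⟨v, hv, hv'⟩ := ((nhdsWithin_inter_Iio_basis hv₀).tendsto_iff
    Metric.nhds_basis_closedBall).1 hl ε hε
  exact ⟨v, hv, fun s hs => hf.rightLimOn_mem hD Metric.isClosed_closedBall hs.2
    fun x hx => hv' x ⟨hx.1, hs.1.trans hx.2.1, hx.2.2⟩⟩

theorem IsRegulatedOn.enorm_rightLimOn_le {D : Set ι} {f : ι → E}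
    (hf : IsRegulatedOn D f) (hD : Dense D) (hmax : ∀ t, IsMax t → t ∈ D) (t : ι) :
    ‖rightLimOn D f t‖ₑ ≤ ⨆ x ∈ D, ‖f x‖ₑ := by
  by_cases ht : IsMax t
  · rw [rightLimOn_of_isMax D f ht]
    exact le_iSup₂ (f := fun x (_ : x ∈ D) => ‖f x‖ₑ) t (hmax t ht)
  · obtain ⟨v, hv⟩ := not_isMax_iff.1 ht
    exact hf.rightLimOn_mem (A := {y | ‖y‖ₑ ≤ ⨆ x ∈ D, ‖f x‖ₑ}) hD
      (isClosed_le continuous_enorm continuous_const) hv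
      fun s hs => le_iSup₂ (f := fun x (_ : x ∈ D) => ‖f x‖ₑ) s hs.1

end RightLimits

/-! ### The RCLL version of a martingale. -/

section Modification

open Classical in
/-- A regularization of a process: the right limits along `D` of its regulated paths, and zero for
the other paths. -/
noncomputable def regularization {ι Ω E : Type*} [LinearOrder ι] [TopologicalSpace ι]
    [NormedAddCommGroup E] (D : Set ι) (Y : ι → Ω → E) (t : ι) (ω : Ω) : E :=
  if IsRegulatedOn D (fun x => Y x ω) then rightLimOn D (fun x => Y x ω) t else 0

variable {ι Ω E : Type*} [LinearOrder ι] [TopologicalSpace ι] [OrderTopology ι] [DenselyOrdered ι]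
  [NormedAddCommGroup E] [CompleteSpace E] {D : Set ι}

theorem regularization_rightContinuous (hD : Dense D) (Y : ι → Ω → E) (ω : Ω) (t : ι) :
    Tendsto (fun s => regularization D Y s ω) (𝓝[>] t) (𝓝 (regularization D Y t ω)) := by
  by_cases h : IsRegulatedOn D (fun x => Y x ω)
  · simpa only [regularization, if_pos h] using h.rightLimOn_rightContinuous hD t
  · simpa only [regularization, if_neg h] using tendsto_const_nhds

theorem regularization_leftLimit (hD : Dense D) (Y : ι → Ω → E) (ω : Ω) (t : ι) :
    ∃ l, Tendsto (fun s => regularization D Y s ω) (𝓝[<] t) (𝓝 l) := by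
  by_cases h : IsRegulatedOn D (fun x => Y x ω)
  · simpa only [regularization, if_pos h] using h.rightLimOn_leftLimit hD t
  · exact ⟨0, by simpa only [regularization, if_neg h] using tendsto_const_nhds⟩

theorem enorm_regularization_le (hD : Dense D) (hmax : ∀ t, IsMax t → t ∈ D) (Y : ι → Ω → E)
    (ω : Ω) (t : ι) : ‖regularization D Y t ω‖ₑ ≤ ⨆ x ∈ D, ‖Y x ω‖ₑ := by
  by_cases h : IsRegulatedOn D (fun x => Y x ω)
  · simpa only [regularization, if_pos h] using h.enorm_rightLimOn_le hD hmax t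
  · simp [regularization, if_neg h]

theorem Dense.exists_seq_tendsto_right [FirstCountableTopology ι] (hD : Dense D) {t v : ι}
    (h : t < v) : ∃ u : ℕ → ι, Tendsto u atTop (𝓝[D ∩ Set.Ioi t] t) ∧
      ∀ n, u n ∈ D ∩ Set.Ioo t v := by
  have hne := hD.nhdsWithin_inter_Ioi_neBot h
  obtain ⟨u, hu⟩ := exists_seq_tendsto (𝓝[D ∩ Set.Ioi t] t)
  obtain ⟨N, hN⟩ := eventually_atTop.1 (hu ((nhdsWithin_inter_Ioi_basis h).mem_of_mem h))
  exact ⟨fun n => u (n + N), (tendsto_add_atTop_iff_nat N).2 hu, fun n => hN _ (by omega)⟩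

variable {mΩ : MeasurableSpace Ω} {P : Measure Ω} [FirstCountableTopology ι] {𝓕 : Filtration ι mΩ}

/-- Below a maximal time, the right limit at `t` is `𝓕 v`-measurable for every `v > t`, hence `𝓕
t`-measurable by right-continuity of the filtration. -/
theorem stronglyAdapted_regularization [SecondCountableTopology E] [h𝓕 : 𝓕.IsRightContinuous]
    {Y : ι → Ω → E} (hY : StronglyAdapted 𝓕 Y) (hD : Dense D)
    (hreg : ∀ t, MeasurableSet[𝓕 t] {ω | IsRegulatedOn D fun x => Y x ω}) :
    StronglyAdapted 𝓕 (regularization D Y) := by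
  classical
  borelize E
  intro t
  by_cases ht : IsMax t
  · have : regularization D Y t =
        fun ω => if IsRegulatedOn D (fun x => Y x ω) then Y t ω else 0 := by
      ext1 ω
      simp only [regularization, rightLimOn_of_isMax D _ ht]
    rw [this]
    exact StronglyMeasurable.ite (hreg t) (hY t) stronglyMeasurable_const
  have hmeas : ∀ v > t, Measurable[𝓕 v] (regularization D Y t) := by
    intro v hv
    obtain ⟨u, hu, huD⟩ := hD.exists_seq_tendsto_right hv
    refine StronglyMeasurable.measurable (stronglyMeasurable_of_tendsto (u := atTop)
      (f := fun n ω => if IsRegulatedOn D (fun x => Y x ω) then Y (u n) ω else 0) (fun n => ?_) ?_)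
    · exact StronglyMeasurable.ite (hreg v) ((hY (u n)).mono (𝓕.mono (huD n).2.2.le))
        stronglyMeasurable_const
    · refine tendsto_pi_nhds.2 fun ω => ?_
      by_cases h : IsRegulatedOn D (fun x => Y x ω)
      · simpa only [regularization, if_pos h, Function.comp_def] using
          (h.tendsto_rightLimOn hD hv).comp hu
      · simpa only [regularization, if_neg h] using tendsto_const_nhds
  have h1 : Measurable[𝓕 t] (regularization D Y t) := by
    intro A hA
    rw [← h𝓕.eq, Filtration.rightCont_eq_of_not_isMax 𝓕 ht]
    simp only [MeasurableSpace.measurableSet_iInf]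
    exact fun v hv => hmeas v hv hA
  exact h1.stronglyMeasurable

variable [NormedSpace ℝ E]

/-- For `s ∈ 𝓕 t` the integrals of `E[V | 𝓕 (u n)]` over `s` all equal that of `V`; as `u n` tends
to `t` from the right, dominated convergence gives the same for the right limit. -/
theorem regularization_condExp_ae_eq [IsFiniteMeasure P] [SecondCountableTopology E]
    [𝓕.IsRightContinuous] {V : Ω → E} (hV : Integrable V P) (hD : Dense D)
    (hDc : D.Countable) (hmax : ∀ t, IsMax t → t ∈ D)
    (hreg : ∀ t, MeasurableSet[𝓕 t] {ω | IsRegulatedOn D fun x => P[V | 𝓕 x] ω})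
    (hreg' : ∀ᵐ ω ∂P, IsRegulatedOn D fun x => P[V | 𝓕 x] ω)
    (hsup : ∫⁻ ω, ⨆ x ∈ D, ‖P[V | 𝓕 x] ω‖ₑ ∂P ≠ ∞) (t : ι) :
    regularization D (fun x => P[V | 𝓕 x]) t =ᵐ[P] P[V | 𝓕 t] := by
  have hadp := stronglyAdapted_regularization (fun x => stronglyMeasurable_condExp) hD hreg
  by_cases ht : IsMax t
  · filter_upwards [hreg'] with ω hω
    simp only [regularization, if_pos hω, rightLimOn_of_isMax D _ ht]
  obtain ⟨v, hv⟩ := not_isMax_iff.1 ht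
  obtain ⟨u, hu, huD⟩ := hD.exists_seq_tendsto_right hv
  have hSmeas : Measurable fun ω => ⨆ x ∈ D, ‖P[V | 𝓕 x] ω‖ₑ :=
    Measurable.biSup _ hDc fun x _ => (stronglyMeasurable_condExp.mono (𝓕.le x)).enorm
  have hb : Integrable (fun ω => (⨆ x ∈ D, ‖P[V | 𝓕 x] ω‖ₑ).toReal) P :=
    integrable_toReal_of_lintegral_ne_top hSmeas.aemeasurable hsup
  have hlt : ∀ᵐ ω ∂P, ⨆ x ∈ D, ‖P[V | 𝓕 x] ω‖ₑ < ∞ := ae_lt_top hSmeas hsup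
  have hint : Integrable (regularization D (fun x => P[V | 𝓕 x]) t) P := by
    refine hb.mono' ((hadp t).mono (𝓕.le t)).aestronglyMeasurable ?_
    filter_upwards [hlt] with ω hω
    rw [← toReal_enorm]
    exact ENNReal.toReal_mono hω.ne (enorm_regularization_le hD hmax _ ω t)
  refine ae_eq_condExp_of_forall_setIntegral_eq (𝓕.le t) hV (fun s _ _ => hint.integrableOn)
    (fun s hs _ => ?_) (hadp t).aestronglyMeasurable
  have hlim : Tendsto (fun n => ∫ ω in s, P[V | 𝓕 (u n)] ω ∂P) atTop
      (𝓝 (∫ ω in s, regularization D (fun x => P[V | 𝓕 x]) t ω ∂P)) := by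
    refine tendsto_integral_of_dominated_convergence
      (fun ω => (⨆ x ∈ D, ‖P[V | 𝓕 x] ω‖ₑ).toReal)
      (fun n => (stronglyMeasurable_condExp.mono (𝓕.le _)).aestronglyMeasurable) hb.integrableOn
      (fun n => ?_) ?_
    · filter_upwards [ae_restrict_of_ae hlt] with ω hω
      rw [← toReal_enorm]
      exact ENNReal.toReal_mono hω.ne
        (le_iSup₂ (f := fun x (_ : x ∈ D) => ‖P[V | 𝓕 x] ω‖ₑ) _ (huD n).1)
    · filter_upwards [ae_restrict_of_ae hreg'] with ω hω
      simpa only [regularization, if_pos hω, Function.comp_def] using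
        (hω.tendsto_rightLimOn hD hv).comp hu
  refine tendsto_nhds_unique hlim (tendsto_const_nhds.congr fun n => ?_)
  exact (setIntegral_condExp (𝓕.le _) hV (𝓕.mono (huD n).2.1.le s hs)).symm

end Modification

/-- Under the usual conditions, the martingale `t ↦ E[V | 𝓕 t]` generated by `V ∈ L^p`, `1 < p`, has
a version whose paths are right-continuous with left limits and have `p`-integrable supremum. -/
theorem exists_rcll_condExp {ι Ω E : Type*} [LinearOrder ι] [TopologicalSpace ι] [OrderTopology ι]
    [DenselyOrdered ι] [SecondCountableTopology ι] [Nonempty ι] {mΩ : MeasurableSpace Ω}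
    {P : Measure Ω} [IsProbabilityMeasure P] [NormedAddCommGroup E] [InnerProductSpace ℝ E]
    [CompleteSpace E] [SecondCountableTopology E] {𝓕 : Filtration ι mΩ} [𝓕.IsRightContinuous]
    (hnull : ∀ (s : Set Ω), P s = 0 → ∀ t, MeasurableSet[𝓕 t] s) {p : ℝ} (hp : 1 < p) {V : Ω → E}
    (hV : MemLp V (ENNReal.ofReal p) P) :
    ∃ X : ι → Ω → E, StronglyAdapted 𝓕 X ∧ (∀ t, X t =ᵐ[P] P[V | 𝓕 t]) ∧
      (∀ ω t, Tendsto (fun s => X s ω) (𝓝[>] t) (𝓝 (X t ω))) ∧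
      (∀ ω t, ∃ l, Tendsto (fun s => X s ω) (𝓝[<] t) (𝓝 l)) ∧
      ∫⁻ ω, (⨆ t, ‖X t ω‖ₑ) ^ p ∂P < ∞ := by
  have hp0 : 0 < p := by linarith
  have hp1 : 1 ≤ ENNReal.ofReal p := by simpa using hp.le
  obtain ⟨D₀, hD₀c, hD₀⟩ := TopologicalSpace.exists_countable_dense ι
  have hmaxc : {t : ι | IsMax t}.Countable :=
    Set.Subsingleton.countable fun s hs t ht =>
      le_antisymm ((le_total s t).elim id fun h => ht h) ((le_total t s).elim id fun h => hs h)
  -- A maximal time has no right limit and must belong to `D`; there is at most one.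
  set D := D₀ ∪ {t : ι | IsMax t}
  have hDc : D.Countable := hD₀c.union hmaxc
  have hD : Dense D := hD₀.mono Set.subset_union_left
  have hmax : ∀ t, IsMax t → t ∈ D := fun t ht => Or.inr ht
  have hreg' : ∀ᵐ ω ∂P, IsRegulatedOn D fun x => P[V | 𝓕 x] ω :=
    ae_isRegulatedOn_condExp 𝓕 hp hV hDc hD.nonempty
  -- The exceptional set is null, so it belongs to every `𝓕 t`.
  have hreg : ∀ t, MeasurableSet[𝓕 t] {ω | IsRegulatedOn D fun x => P[V | 𝓕 x] ω} := fun t =>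
    (@MeasurableSet.compl_iff _ _ (𝓕 t)).1 (hnull _ (mem_ae_iff.1 hreg') t)
  have hVp : Integrable (fun ω => ‖V ω‖ ^ p) P := by
    simpa [ENNReal.toReal_ofReal hp0.le] using
      hV.integrable_norm_rpow (by simpa using hp0) ENNReal.ofReal_ne_top
  have hsup : ∫⁻ ω, (⨆ x ∈ D, ‖P[V | 𝓕 x] ω‖ₑ) ^ p ∂P < ∞ :=
    (lintegral_biSup_condExp_rpow_le 𝓕 hp hVp hDc hD.nonempty).trans_lt ENNReal.ofReal_lt_top
  have hsup1 : ∫⁻ ω, ⨆ x ∈ D, ‖P[V | 𝓕 x] ω‖ₑ ∂P ≠ ∞ := by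
    have h1 : ∫⁻ ω, ⨆ x ∈ D, ‖P[V | 𝓕 x] ω‖ₑ ∂P ≤
        ∫⁻ ω, (1 + (⨆ x ∈ D, ‖P[V | 𝓕 x] ω‖ₑ) ^ p) ∂P := by
      refine lintegral_mono fun ω => ?_
      rcases le_total (⨆ x ∈ D, ‖P[V | 𝓕 x] ω‖ₑ) 1 with h | h
      · exact h.trans le_self_add
      · exact (ENNReal.le_rpow_self_of_one_le h hp.le).trans le_add_self
    refine (h1.trans_lt ?_).ne
    rw [lintegral_add_left measurable_const]
    simpa using hsup
  refine ⟨regularization D fun x => P[V | 𝓕 x],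
    stronglyAdapted_regularization (fun x => stronglyMeasurable_condExp) hD hreg,
    regularization_condExp_ae_eq (hV.integrable hp1) hD hDc hmax hreg hreg' hsup1,
    regularization_rightContinuous hD _, regularization_leftLimit hD _, ?_⟩
  refine (lintegral_mono fun ω => ?_).trans_lt hsup
  exact ENNReal.rpow_le_rpow (iSup_le fun t => enorm_regularization_le hD hmax _ ω t) hp0.le

/-! ### The backward equation. -/

namespace ClassicalBSE

variable {Ω : Type*} {mΩ : MeasurableSpace Ω} {T : ℝ≥0} {𝓕 : Filtration (TimeSet T) mΩ}
  {P : Measure Ω} {p : ℝ≥0∞} {d : ℕ} [IsProbabilityMeasure P] [Fact (1 ≤ p)]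

theorem initialTime_le (t : TimeSet T) : initialTime T ≤ t := t.2.1

theorem exists_martingale_value_eq (h𝓕 : UsualConditions 𝓕 P) (hp_one : 1 < p) (hp_top : p < ∞)
    (V : LpAt 𝓕 P p d (terminalTime T)) : ∃ M : Mp0 𝓕 P p d, ∀ t : TimeSet T,
      (M.value t : Lp (EuclideanSpace ℝ (Fin d)) p P) =
        condAt V (initialTime T) - condAt V t := by
  have := h𝓕.rightContinuous
  have : Nonempty (TimeSet T) := ⟨initialTime T⟩
  have hp : 1 < p.toReal := by
    rw [← ENNReal.toReal_one]
    exact (ENNReal.toReal_lt_toReal (by simp) hp_top.ne).2 hp_one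
  have hp' : ENNReal.ofReal p.toReal = p := ENNReal.ofReal_toReal hp_top.ne
  set v : Ω → EuclideanSpace ℝ (Fin d) :=
    ((V : Lp (EuclideanSpace ℝ (Fin d)) p P) : Ω → EuclideanSpace ℝ (Fin d))
  have hvp : MemLp v p P := Lp.memLp _
  have hvi : Integrable v P := hvp.integrable Fact.out
  have hv0 : MemLp (P[v | 𝓕 (initialTime T)]) p P := memLp_condExp V _
  -- The terminal variable `E_0(V) - V` generates the martingale `E_0(V) - E_t(V)`, which vanishes
  -- at time 0.
  obtain ⟨X, hXa, hXe, hXr, hXl, hXs⟩ := exists_rcll_condExp (𝓕 := 𝓕)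
    (fun s hs t => 𝓕.mono (initialTime_le t) _ (h𝓕.null_measurable s hs)) hp
    (V := P[v | 𝓕 (initialTime T)] - v) (by rw [hp']; exact hv0.sub hvp)
  have hX : ∀ t, X t =ᵐ[P] P[v | 𝓕 (initialTime T)] - P[v | 𝓕 t] := fun t => by
    refine (hXe t).trans ((condExp_sub integrable_condExp hvi _).trans ?_)
    rw [condExp_of_stronglyMeasurable (𝓕.le t)
      (stronglyMeasurable_condExp.mono (𝓕.mono (initialTime_le t))) integrable_condExp]
  let Z : SpProcess 𝓕 P p d :=
    { path := X
      adapted := hXa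
      rightContinuous := hXr
      leftLimit := hXl
      sup_finite := by
        rw [eLpNorm_lt_top_iff_lintegral_rpow_enorm_lt_top (zero_lt_one.trans hp_one).ne' hp_top.ne]
        exact hXs }
  have hval : ∀ t : TimeSet T, (Z.toSp.value t : Lp (EuclideanSpace ℝ (Fin d)) p P) =
      condAt V (initialTime T) - condAt V t := fun t => by
    change (Z.memLp t).toLp (X t) = (memLp_condExp V (initialTime T)).toLp _ -
      (memLp_condExp V t).toLp _
    rw [← MemLp.toLp_sub]
    exact (MemLp.toLp_eq_toLp_iff _ _).2 (hX t)
  refine ⟨⟨Z.toSp, ⟨Z, rfl, ?_⟩, ?_⟩, hval⟩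
  · exact (martingale_condExp _ 𝓕 P).congr hXa fun t => (hXe t).symm
  · exact Subtype.ext ((hval _).trans (sub_self _))

theorem martingaleOf_value (h𝓕 : UsualConditions 𝓕 P) (hp_one : 1 < p) (hp_top : p < ∞)
    (V : LpAt 𝓕 P p d (terminalTime T)) (t : TimeSet T) :
    ((martingaleOf V).value t : Lp (EuclideanSpace ℝ (Fin d)) p P) =
      condAt V (initialTime T) - condAt V t :=
  Classical.epsilon_spec (exists_martingale_value_eq h𝓕 hp_one hp_top V) t

theorem condAt_terminalTime (V : LpAt 𝓕 P p d (terminalTime T)) :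
    (condAt V (terminalTime T) : Lp (EuclideanSpace ℝ (Fin d)) p P) = V := by
  refine Lp.ext ((memLp_condExp V (terminalTime T)).coeFn_toLp.trans ?_)
  exact condExp_of_aestronglyMeasurable' (𝓕.le _)
    (mem_lpMeas_iff_aestronglyMeasurable.1 V.2) ((Lp.memLp _).integrable Fact.out)

theorem solvesForward_solutionOf (F : Sp 𝓕 P p d × Mp0 𝓕 P p d → Sp0 𝓕 P p d) (hS : ConditionS F)
    (V : LpAt 𝓕 P p d (terminalTime T)) :
    SolvesForward F (condAt V (initialTime T)) (martingaleOf V) (solutionOf F hS V) :=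
  (hS (condAt V (initialTime T)) (martingaleOf V)).choose_spec.1

/-- A fixed point of the operator `G` determined by `(F, ξ)` yields a solution of the backward
equation. -/
theorem solvesBSE_of_operatorG_eq (h𝓕 : UsualConditions 𝓕 P) (hp_one : 1 < p) (hp_top : p < ∞)
    {F : Sp 𝓕 P p d × Mp0 𝓕 P p d → Sp0 𝓕 P p d} (hS : ConditionS F)
    {ξ V : LpAt 𝓕 P p d (terminalTime T)} (hV : operatorG F hS ξ V = V) :
    SolvesBSE F ξ (solutionOf F hS V) (martingaleOf V) := by
  intro t
  have h1 := solvesForward_solutionOf F hS V t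
  have h2 : (ξ : Lp (EuclideanSpace ℝ (Fin d)) p P) +
      (F (solutionOf F hS V, martingaleOf V)).value (terminalTime T) = V :=
    congrArg Subtype.val hV
  -- Both sides reduce to `E_0(V)`.
  rw [h1, h2, martingaleOf_value h𝓕 hp_one hp_top V (terminalTime T), condAt_terminalTime]
  abel

end ClassicalBSE

open ClassicalBSE in
theorem theorem6p1 {Ω : Type*} {mΩ : MeasurableSpace Ω} (P : Measure Ω) [IsProbabilityMeasure P]
    (T : ℝ≥0) (𝓕 : Filtration (TimeSet T) mΩ) (h𝓕 : UsualConditions 𝓕 P)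
    (d : ℕ) (p : ℝ≥0∞) [Fact (1 ≤ p)] (hp_one : 1 < p) (hp_top : p < ∞)
    (F : Sp 𝓕 P p d × Mp0 𝓕 P p d → Sp0 𝓕 P p d) (ξ : LpAt 𝓕 P p d (terminalTime T))
    (hS : ConditionS F)
    (hG : ∀ V V' : LpAt 𝓕 P p d (terminalTime T),
      ‖operatorG F hS ξ V - operatorG F hS ξ V'‖ ≤ ‖V - V'‖)
    (H : Set (LpAt 𝓕 P p d (terminalTime T))) (hH_nonempty : H.Nonempty)
    (hH_bounded : Bornology.IsBounded H) (hH_closed : IsClosed H) (hH_convex : Convex ℝ H)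
    (hGH : Set.MapsTo (operatorG F hS ξ) H H) :
    ∃ (Y : Sp 𝓕 P p d) (M : Mp0 𝓕 P p d), SolvesBSE F ξ Y M := by
  -- This inclusion supplies completeness of `L^p(𝓕_T)^d`.
  have : Fact (𝓕 (terminalTime T) ≤ mΩ) := ⟨𝓕.le _⟩
  have : UniformConvexSpace (LpAt 𝓕 P p d (terminalTime T)) :=
    Submodule.uniformConvexSpace (Lp.uniformConvexSpace hp_one hp_top.ne) _
  obtain ⟨V, -, hV⟩ := exists_fixedPoint_of_nonexpansive hH_nonempty hH_bounded hH_closed hH_convex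
    hGH fun V _ V' _ => hG V V'
  exact ⟨_, _, solvesBSE_of_operatorG_eq h𝓕 hp_one hp_top hS hV⟩
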